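/- **Setting.** Six-derivative gravity has the Lagrangian $$\gamma(R-2\Lambda)+\beta R^2-\alpha C_{abcd}C^{abcd}-\eta_1C_{abcd}\Box C^{abcd}+\eta_2R\Box R+\eta_3R^3+\eta_4RS_{ab}S^{ab}+\eta_5S_{ab}S^a{}_cS^{cb}+\eta_6S_{ab}S_{cd}C^{acbd}+\eta_7RC_{abcd}C^{abcd}+\eta_8C_{abcd}C^{abef}C^{cd}{}_{ef}$$ with real couplings ($C$ the Weyl tensor, $S$ the traceless Ricci tensor). For the Kundt ansatz $ds^2=-f(r)\,dt^2+dr^2/f(r)+R_0^2(d\theta^2+\sin^2\theta\,d\phi^2)$, $R_0>0$, put $$q_0=4[9R_0^4\gamma(1-\Lambda R_0^2)-6R_0^2(\alpha-3\beta)+3(12\eta_3+3\eta_4+\eta_6+4\eta_7)+2\eta_8],$$ $$q_1=3R_0^4[2R_0^2(\alpha-3\beta)-36\eta_3+3\eta_4+\eta_6-2(6\eta_7+\eta_8)],\quad q_2=R_0^6w,\quad q_3=-6R_0^6(\eta_1-3\eta_2),$$ $$w=36\eta_3+9\eta_4+3\eta_6+12\eta_7+2\eta_8,$$ $$\sigma_0=-8[9R_0^6\gamma\Lambda-6R_0^2(\alpha-3\beta)+2w],\quad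 \sigma_1=-12R_0^2[3R_0^4\gamma-36\eta_3+3\eta_4+\eta_6-12\eta_7-2\eta_8],\quad \sigma_2=-12R_0^6(\alpha-3\beta),$$ $$\sigma_3=12R_0^4[2R_0^2(\alpha+6\beta)-4(\eta_1-3\eta_2)+72\eta_3-6\eta_4+\eta_6-2\eta_8],\quad \sigma_4=-q_2,\quad \sigma_5=36R_0^6(\eta_1+3\eta_2),$$ $$\sigma_6=-6R_0^6(72\eta_3+6\eta_4-\eta_6-2\eta_8),\quad \sigma_7=24R_0^6(\eta_1+6\eta_2).$$ The vacuum field equations of the theory for this ansatz are $$E_{tt}:\ q_0+q_1(f''^2-2f'f'''-4ff^{(4)})+q_2[f''^3-3(f'f'''+2ff^{(4)})f''-6ff'''^2]+q_3[4f'^2f^{(4)}+(3f'''^2+10f''f^{(4)}+14f'f^{(5)}+4ff^{(6)})f]=0,$$ $$E_{rr}:\ q_0+q_1(f''^2-2f'f''')+q_2(f''^3-3f'f''f''')+q_3[4f'^2f^{(4)}+(f'''^2-2f''f^{(4)}+2f'f^{(5)})f]=0,$$ $$E_{\theta\theta}:\ \sigma_0+\sigma_1f''+\sigma_2f''^2+\sigma_3(f'f'''+ff^{(4)})+\sigma_4f''^3+\sigma_5ff'''^2+\sigma_6[ff'''^2+(f'f'''+ff^{(4)})f'']$$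 $$\qquad+\sigma_7[2f'^2f^{(4)}+(f''f'''+4ff^{(5)})f'+(3f''f^{(4)}+ff^{(6)})f]=0.$$ **(I) Indicial classes.** Let $f=\Delta^n\sum_{i\ge0}a_i\Delta^i$, $\Delta=r-r_0$, $n\in\mathbb R$, $a_0\ne0$, be a formal series satisfying $E_{rr}$ and $E_{\theta\theta}$, or a function given by such a series converging on some interval $r_0<r<r_0+\varepsilon$ and satisfying $E_{rr}$ and $E_{\theta\theta}$ for $r>r_0$ near $r_0$. Then at least one of the following holds: * 1a) $n=3$, $q_0=\sigma_0=\sigma_1=0$, $\sigma_3=-2\sigma_2$; * 1b) $n>2$, $q_0=q_1=\sigma_0=\sigma_1=0$, $n(n-1)\sigma_2+(n-2)(2n-3)\sigma_3=0$ and $q_2n(n-1)(2n-5)-q_3(n-2)(5n^2-21n+20)=0$; * 2) $n=2$, $q_0+4q_1a_0^2+8q_2a_0^3=0$ and $\sigma_0+2\sigma_1a_0+4\sigma_2a_0^2+8\sigma_4a_0^3=0$; * 3a) $n=1$; * 3b) $n=0$; * 3c) $n<2$, $q_2n(n-1)(2n-5)-q_3(n-2)(5n^2-21n+20)=0$ and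 $n(n-1)\{n(n-1)\sigma_4+(n-2)[(n-2)\sigma_5+\sigma_6(3n-5)]\}+\sigma_7(n-2)^3(11n-15)=0$. **(II) Closed-form solutions.** Let $c_1=2(18\eta_3+6\eta_7+\eta_8)$, $c_2=-3(3\eta_4+\eta_6)$. Each of the following functions is smooth and satisfies $E_{tt}$, $E_{rr}$ and $E_{\theta\theta}$ (on $\mathbb R$ in cases A, B, C, D, G, for $r>0$ in cases E, F), and its expansions are of the stated classes. * A. $f=a_0+a_1r$, $a_1\ne0$, if $\gamma\ne0$, $4(\alpha-3\beta)^2-3\gamma w\ge0$, $R_0^2=\frac{2(\alpha-3\beta)\pm\sqrt{4(\alpha-3\beta)^2-3\gamma w}}{3\gamma}$ and $\Lambda=-\frac{2(\alpha-3\beta-3\gamma R_0^2)}{9\gamma R_0^4}$. * B. $f=a_0+a_1r+a_2r^2$, $a_2\ne0$, if, with $x=a_2R_0^2$, $(x+1)\{3c_1(x-1)^2+c_2[2x-3(x^2+1)]+12R_0^2(\alpha-3\beta)(x-1)+9\gamma R_0^4\}=0$ and $c_1(x-1)^3-c_2(x-1)(x+1)^2-9\gamma R_0^4(x-1+2R_0^2\Lambda)=0$.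 * C. $f=a_0+a_1r+a_2r^2+a_3r^3$, $a_3\ne0$, $a_1=\frac{a_2^2R_0^4+2\Lambda R_0^2-1}{3a_3R_0^4}$, if $\gamma\ne0$, $\beta=0$, $\eta_1=3\eta_2=\frac16(6\eta_4-\eta_6)$, $\eta_3=-\frac1{108}(3\eta_4+4\eta_6+12\eta_7)$, $2\eta_1-6\eta_2+w=0$, $R_0^2=\frac23\sqrt{c_2/\gamma}$, and either $\Lambda=0$ or ($\gamma>0$ and $\alpha=\frac12\sqrt{\gamma c_2}$). In A, B, C, at any point $r_0$ where $f$ vanishes exactly to order $m\le3$, the expansion is of class 3b, 3a, 2, 1a for $m=0,1,2,3$ respectively. * D. $f=a_3r^3-\frac{45a_3^2}{64\Lambda}r^4$, $a_3\ne0$, if $\gamma\neq0$, $R_0^2=\frac1\Lambda$, $\alpha=3\beta-\frac{3\gamma}{2\Lambda}$, $\eta_1=-15\eta_2=\frac{45\gamma}{32\Lambda^2}$, $\eta_4=\frac{48\beta\Lambda-13\gamma}{48\Lambda^2}$, $\eta_6=-\frac{48\beta\Lambda+35\gamma}{16\Lambda^2}$, $\eta_7=\frac{39\gamma-48\Lambda(\beta+12\eta_3\Lambda)}{64\Lambda^2}$,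 $\eta_8=\frac{9(16\Lambda(\beta+8\eta_3\Lambda)-13\gamma)}{32\Lambda^2}$: class 1a at $r_0=0$, with $q_1=-18\gamma/\Lambda^4\ne0$. * E. $f=a_2r^2+a_pr^p$, $a_p\ne0$, $p\in\mathbb R\setminus\{0,1\}$, if $\gamma=0$, $\alpha=3\beta$, $\eta_1=3\eta_2$, $\eta_6=-3\eta_4$, $\eta_7=\frac{6(p-2)(2p-3)\eta_2}{(p-1)p}-9\eta_3-\frac34\eta_4$, $\eta_8=-6(3\eta_3+\eta_7)$, $R_0^2=-\frac{4(p-2)(2p-3)\eta_2-(p-1)p\eta_4}{(p-1)p\beta+(p-3)(p-2)(p^2+p-4)a_2\eta_2}$ (the denominator being nonzero). At $r_0=0$ it is of class 1b if $a_2=0$, $p>2$; of class 2 if $a_2\ne0$ and $p-2$ is a positive integer; of class 3c if $p<2$ and either $a_2=0$ or $p$ is an integer. * F. $f=a_pr^p$, $a_p\ne0$, $p\in\mathbb R\setminus\{0,1,\frac32,2,\frac1{10}(21\pm\sqrt{41})\}$, if $R_0^2=\frac1{3\Lambda}$ and, with $Q=p(5p-21)+20$, $\alpha=9\eta_4\Lambda-\frac{\gamma(p-1)(3p-4)p^2}{36\Lambda(p-2)(2p-3)Q}-\frac{12\eta_1\Lambda(p-2)(2p-3)}{(p-1)p}$,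 $\beta=-\frac{\gamma}{6\Lambda}+3\eta_4\Lambda-\frac{\gamma(p-1)(3p-4)p^2}{108\Lambda(p-2)(2p-3)Q}-\frac{4\eta_1\Lambda(p-2)(2p-3)}{(p-1)p}$, $\eta_2=\frac{\eta_1}3+\frac{\gamma(p-1)p(2p-5)}{54\Lambda^2(p-2)Q}$, $\eta_6=-3\eta_4$, $\eta_7=-9\eta_3-\frac{3\eta_4}4+\frac{\gamma(7p-15)[13(p-4)p+48]}{216\Lambda^2(p-2)Q}+\frac{2\eta_1(p-2)(2p-3)}{(p-1)p}$, $\eta_8=36\eta_3+\frac{9\eta_4}2+\gamma\frac{p[(373-61p)p-744]+480}{36\Lambda^2(p-2)Q}-\frac{12\eta_1(p-2)(2p-3)}{(p-1)p}$. At $r_0=0$ it is of class 1b if $p>2$ and of class 3c if $p<2$. * G. $f=\frac{15\gamma r^2}{8\delta}+a_4r^4$, $a_4\ne0$, $\delta=\alpha-3\beta\ne0$, $\gamma\ne0$, if $\eta_1=-69\eta_2=\frac{391\delta^2}{2214\gamma}$, $\eta_4=\frac{2(104\alpha-5847\beta)\delta}{16605\gamma}$, $\eta_6=\frac{2\delta(1201\alpha+1932\beta)}{5535\gamma}$,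 $\eta_7=-\frac{(1987\alpha-22566\beta)\delta}{33210\gamma}-9\eta_3$, $\eta_8=-\frac{\delta(4648\alpha+2661\beta)}{5535\gamma}+36\eta_3$, $\Lambda=-\frac{8883\gamma}{1312\delta}$, $R_0^2=-\frac{2\delta}{3\gamma}$: class 2 at $r_0=0$. **(III) All classes occur.** There are solutions of form C and of form D in class 1a; of forms E and F in class 1b; of forms B, C, E and G in class 2; of forms A, B and C in class 3a; of forms A, B and C in class 3b; of forms E and F in class 3c. In each case the model can be chosen such that not every smooth $f$ satisfies its field equations. -/

import Mathlib

open Filter Topology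
open scoped ContDiff

/-- Coupling constants of the general six-derivative gravity action
`∫ √(-g) [γ (R - 2 Λ) + β R² - α C_{abcd} C^{abcd} - η₁ C_{abcd} □ C^{abcd} + η₂ R □ R + η₃ R³
  + η₄ R S_{ab} S^{ab} + η₅ S_{ab} S^a_c S^{cb} + η₆ S_{ab} S_{cd} C^{acbd}
  + η₇ R C_{abcd} C^{abcd} + η₈ C_{abcd} C^{abef} C^{cd}_{ef}]`,
with `C` the Weyl tensor and `S` the traceless Ricci tensor. -/
structure Couplings where
  γ : ℝ
  Λ : ℝ
  α : ℝ
  β : ℝ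
  η₁ : ℝ
  η₂ : ℝ
  η₃ : ℝ
  η₄ : ℝ
  η₅ : ℝ
  η₆ : ℝ
  η₇ : ℝ
  η₈ : ℝ

namespace Kundt

/-! ### Field equations

The vacuum field equations for the Kundt ansatz
`ds² = - f(r) dt² + dr² / f(r) + R₀² (dθ² + sin² θ dφ²)`.
Their left-hand sides are differential polynomials in `f`; `f k` stands for the `k`-th derivative,
taken in an arbitrary commutative `ℝ`-algebra, so that the same expressions apply to functions
(pointwise) and to formal series. -/

section FieldEquations

variable {A : Type*} [CommRing A] [Algebra ℝ A]

/-- Left-hand side of the `tt` equation. -/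
noncomputable def Ett (M : Couplings) (R₀ : ℝ) (f : ℕ → A) : A :=
  algebraMap ℝ A (36 * R₀ ^ 4 * M.γ * (1 - M.Λ * R₀ ^ 2) - 24 * R₀ ^ 2 * (M.α - 3 * M.β)
      + 12 * (12 * M.η₃ + 3 * M.η₄ + M.η₆ + 4 * M.η₇) + 8 * M.η₈)
    + (3 * R₀ ^ 4 * (2 * R₀ ^ 2 * (M.α - 3 * M.β) - 36 * M.η₃ + 3 * M.η₄ + M.η₆
        - 12 * M.η₇ - 2 * M.η₈)) • (f 2 ^ 2 - 2 * f 1 * f 3 - 4 * f 0 * f 4)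
    + (R₀ ^ 6 * (36 * M.η₃ + 9 * M.η₄ + 3 * M.η₆ + 12 * M.η₇ + 2 * M.η₈)) •
        (f 2 ^ 3 - 3 * (f 1 * f 3 + 2 * f 0 * f 4) * f 2 - 6 * f 0 * f 3 ^ 2)
    - (6 * R₀ ^ 6 * (M.η₁ - 3 * M.η₂)) •
        (4 * f 1 ^ 2 * f 4
          + (3 * f 3 ^ 2 + 10 * f 2 * f 4 + 14 * f 1 * f 5 + 4 * f 0 * f 6) * f 0)

/-- Left-hand side of the `rr` equation. -/
noncomputable def Err (M : Couplings) (R₀ : ℝ) (f : ℕ → A) : A :=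
  algebraMap ℝ A (36 * R₀ ^ 4 * M.γ * (1 - M.Λ * R₀ ^ 2) - 24 * R₀ ^ 2 * (M.α - 3 * M.β)
      + 12 * (12 * M.η₃ + 3 * M.η₄ + M.η₆ + 4 * M.η₇) + 8 * M.η₈)
    + (3 * R₀ ^ 4 * (2 * R₀ ^ 2 * (M.α - 3 * M.β) - 36 * M.η₃ + 3 * M.η₄ + M.η₆
        - 12 * M.η₇ - 2 * M.η₈)) • (f 2 ^ 2 - 2 * f 1 * f 3)
    + (R₀ ^ 6 * (36 * M.η₃ + 9 * M.η₄ + 3 * M.η₆ + 12 * M.η₇ + 2 * M.η₈)) •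
        (f 2 ^ 3 - 3 * f 1 * f 2 * f 3)
    - (6 * R₀ ^ 6 * (M.η₁ - 3 * M.η₂)) •
        (4 * f 1 ^ 2 * f 4 + (f 3 ^ 2 - 2 * f 2 * f 4 + 2 * f 1 * f 5) * f 0)

/-- Left-hand side of the `θθ` equation (the `φφ` equation is `sin² θ` times it). -/
noncomputable def Eθθ (M : Couplings) (R₀ : ℝ) (f : ℕ → A) : A :=
  algebraMap ℝ A (-72 * R₀ ^ 6 * M.γ * M.Λ + 48 * R₀ ^ 2 * (M.α - 3 * M.β)
      - 16 * (36 * M.η₃ + 9 * M.η₄ + 3 * M.η₆ + 12 * M.η₇ + 2 * M.η₈))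
    - (12 * R₀ ^ 2 * (3 * R₀ ^ 4 * M.γ - 36 * M.η₃ + 3 * M.η₄ + M.η₆
        - 12 * M.η₇ - 2 * M.η₈)) • f 2
    - (12 * R₀ ^ 6 * (M.α - 3 * M.β)) • f 2 ^ 2
    + (12 * R₀ ^ 4 * (2 * R₀ ^ 2 * (M.α + 6 * M.β) - 4 * M.η₁ + 12 * M.η₂ + 72 * M.η₃
        - 6 * M.η₄ + M.η₆ - 2 * M.η₈)) • (f 1 * f 3 + f 0 * f 4)
    - (R₀ ^ 6 * (36 * M.η₃ + 9 * M.η₄ + 3 * M.η₆ + 12 * M.η₇ + 2 * M.η₈)) • f 2 ^ 3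
    + (36 * R₀ ^ 6 * (M.η₁ + 3 * M.η₂)) • (f 0 * f 3 ^ 2)
    - (6 * R₀ ^ 6 * (72 * M.η₃ + 6 * M.η₄ - M.η₆ - 2 * M.η₈)) •
        (f 0 * f 3 ^ 2 + (f 1 * f 3 + f 0 * f 4) * f 2)
    + (24 * R₀ ^ 6 * (M.η₁ + 6 * M.η₂)) •
        (2 * f 1 ^ 2 * f 4 + (f 2 * f 3 + 4 * f 0 * f 5) * f 1
          + (3 * f 2 * f 4 + f 0 * f 6) * f 0)

end FieldEquations

/-- The derivatives of a real function at a point. -/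
noncomputable def jet (f : ℝ → ℝ) (r : ℝ) : ℕ → ℝ := fun k => iteratedDeriv k f r

/-- `f` is smooth on `s` and the Kundt metric built from `f` and `R₀` satisfies the vacuum field
equations of the model `M` there. -/
def IsVacuumOn (M : Couplings) (R₀ : ℝ) (f : ℝ → ℝ) (s : Set ℝ) : Prop :=
  ContDiffOn ℝ ∞ f s ∧
    ∀ r ∈ s, Ett M R₀ (jet f r) = 0 ∧ Err M R₀ (jet f r) = 0 ∧ Eθθ M R₀ (jet f r) = 0

/-! ### Series `Δ^n ∑ a_i Δ^i` -/

/-- On some interval `r₀ < r < r₀ + ε`, `f r` is the sum of the convergent series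
`Δ^n ∑ a_i Δ^i`, `Δ = r - r₀`, with `a_0 ≠ 0`. The leading exponent `n` is any real number. -/
def HasFrobeniusSeries (f : ℝ → ℝ) (r₀ n : ℝ) (a : ℕ → ℝ) : Prop :=
  a 0 ≠ 0 ∧ ∃ ε > 0, ∀ r ∈ Set.Ioo r₀ (r₀ + ε),
    HasSum (fun i : ℕ => a i * (r - r₀) ^ (n + (i : ℝ))) (f r)

/-- Formal derivative of a generalized power series in `Δ` with real exponents:
`Δ^x` is sent to `x Δ^(x-1)`. -/
noncomputable def formalDeriv (F : HahnSeries ℝ ℝ) : HahnSeries ℝ ℝ where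
  coeff x := (x + 1) * F.coeff (x + 1)
  isPWO_support' := by
    refine Set.IsPWO.mono (F.isPWO_support.image_of_monotone (f := fun x : ℝ => x - 1)
      (fun x y h => sub_le_sub_right h 1)) ?_
    intro x hx
    refine ⟨x + 1, ?_, add_sub_cancel_right x 1⟩
    exact fun h => hx (by
      change (x + 1) * F.coeff (x + 1) = 0
      rw [h, mul_zero])

/-- The derivatives of a formal series. -/
noncomputable def formalJet (F : HahnSeries ℝ ℝ) : ℕ → HahnSeries ℝ ℝ :=
  fun k => formalDeriv^[k] F

/-- The formal series `Δ^n ∑ a_i Δ^i`. -/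
noncomputable def frobenius (n : ℝ) (a : ℕ → ℝ) : HahnSeries ℝ ℝ :=
  HahnSeries.single n 1 * HahnSeries.ofPowerSeries ℝ ℝ (PowerSeries.mk a)

/-! ### Coefficients of the `rr` and `θθ` equations -/

section Coefficients

variable (M : Couplings) (R₀ : ℝ)

def q₀ : ℝ :=
  4 * (9 * R₀ ^ 4 * M.γ * (1 - M.Λ * R₀ ^ 2) - 6 * R₀ ^ 2 * (M.α - 3 * M.β)
    + 3 * (12 * M.η₃ + 3 * M.η₄ + M.η₆ + 4 * M.η₇) + 2 * M.η₈)

def q₁ : ℝ :=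
  3 * R₀ ^ 4 * (2 * R₀ ^ 2 * (M.α - 3 * M.β) - 36 * M.η₃ + 3 * M.η₄ + M.η₆
    - 2 * (6 * M.η₇ + M.η₈))

def q₂ : ℝ := R₀ ^ 6 * (3 * (12 * M.η₃ + 3 * M.η₄ + M.η₆ + 4 * M.η₇) + 2 * M.η₈)

def q₃ : ℝ := -6 * R₀ ^ 6 * (M.η₁ - 3 * M.η₂)

def σ₀ : ℝ :=
  -8 * (9 * R₀ ^ 6 * M.γ * M.Λ - 6 * R₀ ^ 2 * (M.α - 3 * M.β)
    + 2 * (36 * M.η₃ + 9 * M.η₄ + 3 * M.η₆ + 12 * M.η₇ + 2 * M.η₈))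

def σ₁ : ℝ :=
  -12 * R₀ ^ 2 * (3 * R₀ ^ 4 * M.γ - 36 * M.η₃ + 3 * M.η₄ + M.η₆ - 12 * M.η₇ - 2 * M.η₈)

def σ₂ : ℝ := -12 * R₀ ^ 6 * (M.α - 3 * M.β)

def σ₃ : ℝ :=
  12 * R₀ ^ 4 * (2 * R₀ ^ 2 * (M.α + 6 * M.β) - 4 * (M.η₁ - 3 * M.η₂) + 72 * M.η₃
    - 6 * M.η₄ + M.η₆ - 2 * M.η₈)

def σ₄ : ℝ := -R₀ ^ 6 * (36 * M.η₃ + 9 * M.η₄ + 3 * M.η₆ + 12 * M.η₇ + 2 * M.η₈)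

def σ₅ : ℝ := 36 * R₀ ^ 6 * (M.η₁ + 3 * M.η₂)

def σ₆ : ℝ := -6 * R₀ ^ 6 * (72 * M.η₃ + 6 * M.η₄ - M.η₆ - 2 * M.η₈)

def σ₇ : ℝ := 24 * R₀ ^ 6 * (M.η₁ + 6 * M.η₂)

end Coefficients

/-! ### The six indicial classes -/

inductive IndicialClass
  | c1a | c1b | c2 | c3a | c3b | c3c

/-- The conditions on the leading exponent `n`, the leading coefficient `a₀` and the model that
define each class. -/
def InClass (M : Couplings) (R₀ n a₀ : ℝ) : IndicialClass → Prop
  | .c1a => n = 3 ∧ q₀ M R₀ = 0 ∧ σ₀ M R₀ = 0 ∧ σ₁ M R₀ = 0 ∧ σ₃ M R₀ = -2 * σ₂ M R₀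
  | .c1b => 2 < n ∧ q₀ M R₀ = 0 ∧ q₁ M R₀ = 0 ∧ σ₀ M R₀ = 0 ∧ σ₁ M R₀ = 0 ∧
      n * (n - 1) * σ₂ M R₀ + (n - 2) * (2 * n - 3) * σ₃ M R₀ = 0 ∧
      q₂ M R₀ * n * (n - 1) * (2 * n - 5)
        - q₃ M R₀ * (n - 2) * (5 * n ^ 2 - 21 * n + 20) = 0
  | .c2 => n = 2 ∧
      q₀ M R₀ + 4 * q₁ M R₀ * a₀ ^ 2 + 8 * q₂ M R₀ * a₀ ^ 3 = 0 ∧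
      σ₀ M R₀ + 2 * σ₁ M R₀ * a₀ + 4 * σ₂ M R₀ * a₀ ^ 2 + 8 * σ₄ M R₀ * a₀ ^ 3 = 0
  | .c3a => n = 1
  | .c3b => n = 0
  | .c3c => n < 2 ∧
      q₂ M R₀ * n * (n - 1) * (2 * n - 5)
        - q₃ M R₀ * (n - 2) * (5 * n ^ 2 - 21 * n + 20) = 0 ∧
      n * (n - 1) * (n * (n - 1) * σ₄ M R₀
          + (n - 2) * ((n - 2) * σ₅ M R₀ + σ₆ M R₀ * (3 * n - 5)))
        + σ₇ M R₀ * (n - 2) ^ 3 * (11 * n - 15) = 0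

/-- `f` is a vacuum solution on some interval `r₀ < r < r₀ + ε`, has there an expansion
`Δ^n ∑ a_i Δ^i`, and this expansion belongs to the class `K`. -/
def RealizesAt (M : Couplings) (R₀ : ℝ) (f : ℝ → ℝ) (r₀ : ℝ) (K : IndicialClass) : Prop :=
  (∃ ε > 0, IsVacuumOn M R₀ f (Set.Ioo r₀ (r₀ + ε))) ∧
    ∃ (n : ℝ) (a : ℕ → ℝ), HasFrobeniusSeries f r₀ n a ∧ InClass M R₀ n (a 0) K

/-- The class of a solution that vanishes to order `m ≤ 3` at the expansion point. -/
def classOfOrder : ℕ → IndicialClass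
  | 0 => .c3b
  | 1 => .c3a
  | 2 => .c2
  | _ => .c1a

/-- At each point `r₀`, if `f` vanishes exactly to order `m ≤ 3` there, then `f` realizes the
class with leading exponent `m`. -/
def RealizesByOrder (M : Couplings) (R₀ : ℝ) (f : ℝ → ℝ) : Prop :=
  ∀ (r₀ : ℝ) (m : ℕ), m ≤ 3 → (∀ j < m, iteratedDeriv j f r₀ = 0) →
    iteratedDeriv m f r₀ ≠ 0 → RealizesAt M R₀ f r₀ (classOfOrder m)

/-! ### Closed-form functions and the models that go with them -/

def c₁ (M : Couplings) : ℝ := 2 * (18 * M.η₃ + 6 * M.η₇ + M.η₈)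

def c₂ (M : Couplings) : ℝ := -3 * (3 * M.η₄ + M.η₆)

def w (M : Couplings) : ℝ := 36 * M.η₃ + 9 * M.η₄ + 3 * M.η₆ + 12 * M.η₇ + 2 * M.η₈

/-- `f = a₀ + a₁ r`. -/
def IsLinearForm (M : Couplings) (R₀ : ℝ) (f : ℝ → ℝ) : Prop :=
  M.γ ≠ 0 ∧ 0 ≤ 4 * (M.α - 3 * M.β) ^ 2 - 3 * M.γ * w M ∧
  (R₀ ^ 2 = (2 * (M.α - 3 * M.β) + √(4 * (M.α - 3 * M.β) ^ 2 - 3 * M.γ * w M)) / (3 * M.γ) ∨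
   R₀ ^ 2 = (2 * (M.α - 3 * M.β) - √(4 * (M.α - 3 * M.β) ^ 2 - 3 * M.γ * w M)) / (3 * M.γ)) ∧
  M.Λ = -(2 * (M.α - 3 * M.β - 3 * M.γ * R₀ ^ 2)) / (9 * M.γ * R₀ ^ 4) ∧
  ∃ a₀ a₁ : ℝ, a₁ ≠ 0 ∧ f = fun r => a₀ + a₁ * r

/-- `f = a₀ + a₁ r + a₂ r²`. -/
def IsQuadraticForm (M : Couplings) (R₀ : ℝ) (f : ℝ → ℝ) : Prop :=
  ∃ a₀ a₁ a₂ : ℝ, a₂ ≠ 0 ∧ (f = fun r => a₀ + a₁ * r + a₂ * r ^ 2) ∧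
    (a₂ * R₀ ^ 2 + 1) * (3 * c₁ M * (a₂ * R₀ ^ 2 - 1) ^ 2
      + c₂ M * (2 * a₂ * R₀ ^ 2 - 3 * (a₂ ^ 2 * R₀ ^ 4 + 1))
      + 12 * R₀ ^ 2 * (M.α - 3 * M.β) * (a₂ * R₀ ^ 2 - 1) + 9 * M.γ * R₀ ^ 4) = 0 ∧
    c₁ M * (a₂ * R₀ ^ 2 - 1) ^ 3 - c₂ M * (a₂ * R₀ ^ 2 - 1) * (a₂ * R₀ ^ 2 + 1) ^ 2
      - 9 * M.γ * R₀ ^ 4 * (a₂ * R₀ ^ 2 - 1 + 2 * R₀ ^ 2 * M.Λ) = 0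

/-- `f = a₀ + a₁ r + a₂ r² + a₃ r³`. -/
def IsCubicForm (M : Couplings) (R₀ : ℝ) (f : ℝ → ℝ) : Prop :=
  M.γ ≠ 0 ∧ M.β = 0 ∧ M.η₁ = 3 * M.η₂ ∧ M.η₁ = (6 * M.η₄ - M.η₆) / 6 ∧
  M.η₃ = -(3 * M.η₄ + 4 * M.η₆ + 12 * M.η₇) / 108 ∧
  2 * M.η₁ - 6 * M.η₂ + w M = 0 ∧
  R₀ ^ 2 = 2 / 3 * √(c₂ M / M.γ) ∧
  (M.Λ = 0 ∨ (0 < M.γ ∧ M.α = 1 / 2 * √(M.γ * c₂ M))) ∧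
  ∃ a₀ a₁ a₂ a₃ : ℝ, a₃ ≠ 0 ∧
    a₁ = (a₂ ^ 2 * R₀ ^ 4 + 2 * M.Λ * R₀ ^ 2 - 1) / (3 * a₃ * R₀ ^ 4) ∧
    f = fun r => a₀ + a₁ * r + a₂ * r ^ 2 + a₃ * r ^ 3

/-- `f = a₃ r³ - 45 a₃² r⁴ / (64 Λ)`. -/
def IsCubicQuarticForm (M : Couplings) (R₀ : ℝ) (f : ℝ → ℝ) : Prop :=
  R₀ ^ 2 = 1 / M.Λ ∧ M.γ ≠ 0 ∧
  M.α = 3 * M.β - 3 * M.γ / (2 * M.Λ) ∧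
  M.η₁ = -15 * M.η₂ ∧ M.η₁ = 45 * M.γ / (32 * M.Λ ^ 2) ∧
  M.η₄ = (48 * M.β * M.Λ - 13 * M.γ) / (48 * M.Λ ^ 2) ∧
  M.η₆ = -(48 * M.β * M.Λ + 35 * M.γ) / (16 * M.Λ ^ 2) ∧
  M.η₇ = (39 * M.γ - 48 * M.Λ * (M.β + 12 * M.η₃ * M.Λ)) / (64 * M.Λ ^ 2) ∧
  M.η₈ = 9 * (16 * M.Λ * (M.β + 8 * M.η₃ * M.Λ) - 13 * M.γ) / (32 * M.Λ ^ 2) ∧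
  ∃ a₃ : ℝ, a₃ ≠ 0 ∧ f = fun r => a₃ * r ^ 3 - 45 * a₃ ^ 2 * r ^ 4 / (64 * M.Λ)

/-- The model and the radius that go with `f = a₂ r² + a_p r^p`, for `γ = 0`. -/
def IsTwoTermModel (M : Couplings) (R₀ p a₂ : ℝ) : Prop :=
  p ≠ 0 ∧ p ≠ 1 ∧ M.γ = 0 ∧ M.α = 3 * M.β ∧ M.η₁ = 3 * M.η₂ ∧ M.η₆ = -3 * M.η₄ ∧
  M.η₇ = 6 * (p - 2) * (2 * p - 3) * M.η₂ / ((p - 1) * p) - 9 * M.η₃ - 3 * M.η₄ / 4 ∧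
  M.η₈ = -6 * (3 * M.η₃ + M.η₇) ∧
  R₀ ^ 2 = -((4 * (p - 2) * (2 * p - 3) * M.η₂ - (p - 1) * p * M.η₄) /
    ((p - 1) * p * M.β + (p - 3) * (p - 2) * (p ^ 2 + p - 4) * a₂ * M.η₂))

/-- `f = a₂ r² + a_p r^p`; real powers, for `r > 0`. -/
noncomputable def twoTerm (p a₂ ap : ℝ) : ℝ → ℝ := fun r => a₂ * r ^ 2 + ap * r ^ p

def IsTwoTermForm (M : Couplings) (R₀ : ℝ) (f : ℝ → ℝ) : Prop :=
  ∃ p a₂ ap : ℝ, ap ≠ 0 ∧ IsTwoTermModel M R₀ p a₂ ∧ f = twoTerm p a₂ ap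

/-- The model and the radius that go with `f = a_p r^p`, with `γ` arbitrary. -/
def IsPowerModel (M : Couplings) (R₀ p : ℝ) : Prop :=
  p ≠ 0 ∧ p ≠ 1 ∧ p ≠ 3 / 2 ∧ p ≠ 2 ∧ p ≠ (21 + √41) / 10 ∧ p ≠ (21 - √41) / 10 ∧
  R₀ ^ 2 = 1 / (3 * M.Λ) ∧
  M.α = 9 * M.η₄ * M.Λ
    - M.γ * (p - 1) * (3 * p - 4) * p ^ 2
      / (36 * M.Λ * (p - 2) * (2 * p - 3) * (p * (5 * p - 21) + 20))
    - 12 * M.η₁ * M.Λ * (p - 2) * (2 * p - 3) / ((p - 1) * p) ∧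
  M.β = -M.γ / (6 * M.Λ) + 3 * M.η₄ * M.Λ
    - M.γ * (p - 1) * (3 * p - 4) * p ^ 2
      / (108 * M.Λ * (p - 2) * (2 * p - 3) * (p * (5 * p - 21) + 20))
    - 4 * M.η₁ * M.Λ * (p - 2) * (2 * p - 3) / ((p - 1) * p) ∧
  M.η₂ = M.η₁ / 3
    + M.γ * (p - 1) * p * (2 * p - 5)
      / (54 * M.Λ ^ 2 * (p - 2) * (p * (5 * p - 21) + 20)) ∧
  M.η₆ = -3 * M.η₄ ∧
  M.η₇ = -9 * M.η₃ - 3 * M.η₄ / 4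
    + M.γ * (7 * p - 15) * (13 * (p - 4) * p + 48)
      / (216 * M.Λ ^ 2 * (p - 2) * (p * (5 * p - 21) + 20))
    + 2 * M.η₁ * (p - 2) * (2 * p - 3) / ((p - 1) * p) ∧
  M.η₈ = 36 * M.η₃ + 9 * M.η₄ / 2
    + M.γ * (p * ((373 - 61 * p) * p - 744) + 480)
      / (36 * M.Λ ^ 2 * (p - 2) * (p * (5 * p - 21) + 20))
    - 12 * M.η₁ * (p - 2) * (2 * p - 3) / ((p - 1) * p)

def IsPowerForm (M : Couplings) (R₀ : ℝ) (f : ℝ → ℝ) : Prop :=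
  ∃ p ap : ℝ, ap ≠ 0 ∧ IsPowerModel M R₀ p ∧ f = fun r => ap * r ^ p

/-- `f = 15 γ r² / (8 (α - 3 β)) + a₄ r⁴`. -/
def IsQuadraticQuarticForm (M : Couplings) (R₀ : ℝ) (f : ℝ → ℝ) : Prop :=
  M.γ ≠ 0 ∧ M.α ≠ 3 * M.β ∧
  M.η₁ = -69 * M.η₂ ∧ M.η₁ = 391 * (M.α - 3 * M.β) ^ 2 / (2214 * M.γ) ∧
  M.η₄ = 2 * (104 * M.α - 5847 * M.β) * (M.α - 3 * M.β) / (16605 * M.γ) ∧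
  M.η₆ = 2 * (M.α - 3 * M.β) * (1201 * M.α + 1932 * M.β) / (5535 * M.γ) ∧
  M.η₇ = -((1987 * M.α - 22566 * M.β) * (M.α - 3 * M.β)) / (33210 * M.γ) - 9 * M.η₃ ∧
  M.η₈ = -((M.α - 3 * M.β) * (4648 * M.α + 2661 * M.β)) / (5535 * M.γ) + 36 * M.η₃ ∧
  M.Λ = -(8883 * M.γ) / (1312 * (M.α - 3 * M.β)) ∧
  R₀ ^ 2 = -(2 * (M.α - 3 * M.β)) / (3 * M.γ) ∧
  ∃ a₄ : ℝ, a₄ ≠ 0 ∧ f = fun r => 15 * M.γ * r ^ 2 / (8 * (M.α - 3 * M.β)) + a₄ * r ^ 4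

/-- The class `K` is realized by a closed-form solution of the given form, in a model that is not
degenerate in the sense that every smooth `f` would solve its field equations. -/
def Realized (Form : Couplings → ℝ → (ℝ → ℝ) → Prop) (K : IndicialClass) : Prop :=
  ∃ (M : Couplings) (R₀ : ℝ) (f : ℝ → ℝ) (r₀ : ℝ), 0 < R₀ ∧ Form M R₀ f ∧
    (∃ g : ℝ → ℝ, ContDiff ℝ ∞ g ∧ ¬ IsVacuumOn M R₀ g Set.univ) ∧
    RealizesAt M R₀ f r₀ K

end Kundt

/-! Indicial classes. Every monomial of degree `d` in `f` and its derivatives carries exactly `2 d`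
derivatives in the field equations. If the `k`-th derivative is `Δ^(n-k)` times a factor `g k` with
limit `a₀ n (n-1) ⋯ (n-k+1)`, then a monomial of degree `d` is `Δ^(d (n-2))` times the same monomial
in the `g k` (`Err_of_isRescaled`, `Eθθ_of_isRescaled`). With `u = Δ^(n-2)` the equations become
cubic polynomials in `u` whose coefficients have explicit limits (`IsLimitRelation.limits`). For `n
< 2` the cubic terms dominate, for `n = 2` all degrees count, and for `n > 2` the coefficients
vanish one degree after another (`IsLimitRelation.exists_inClass`). The argument needs only sums,
products and uniqueness of limits, so one abstract proof covers constant terms of formal series with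
real exponents and one-sided limits of functions.

Closed forms. Polynomials have explicit towers of derivatives. For `a₂ r² + a_p r^p` the same
homogeneity removes `r`, up to the single quantity `a_p r^(p-2)`, and leaves polynomial identities
in the couplings. The classes of their expansions then come from the indicial theorem itself: it
yields some class, and the exponent, sometimes with a few coupling identities, decides which
(`IsVacuumOn.realizesAt`). Explicit models with `R₀ = 1` realize every class. -/

namespace Kundt

/-! ### Homogeneity of the field equations -/

section Scaling

variable {A : Type*} [CommRing A] [Algebra ℝ A]

/-- The derivatives `f k` are `u τ ^ (2 - k) g k`, where `s` is the inverse of `τ`. -/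
structure IsRescaled (u τ s : A) (f g : ℕ → A) : Prop where
  inv : τ * s = 1
  zero : f 0 = u * τ ^ 2 * g 0
  one : f 1 = u * τ * g 1
  two : f 2 = u * g 2
  three : f 3 = u * s * g 3
  four : f 4 = u * s ^ 2 * g 4
  five : f 5 = u * s ^ 3 * g 5
  six : f 6 = u * s ^ 4 * g 6

/-- A monomial of degree `d` contains `2 d` derivatives, so the powers of `τ` and `s` cancel by `τ *
s = 1` and only `u ^ d` is left. -/
theorem Ett_of_isRescaled (M : Couplings) (R₀ : ℝ) {u τ s : A} {f g : ℕ → A}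
    (h : IsRescaled u τ s f g) :
    Ett M R₀ f = algebraMap ℝ A (q₀ M R₀)
      + q₁ M R₀ • (u ^ 2 * (g 2 ^ 2 - 2 * g 1 * g 3 - 4 * g 0 * g 4))
      + q₂ M R₀ • (u ^ 3 * (g 2 ^ 3 - 3 * (g 1 * g 3 + 2 * g 0 * g 4) * g 2
          - 6 * g 0 * g 3 ^ 2))
      + q₃ M R₀ • (u ^ 3 * (4 * g 1 ^ 2 * g 4
          + (3 * g 3 ^ 2 + 10 * g 2 * g 4 + 14 * g 1 * g 5 + 4 * g 0 * g 6) * g 0)) := by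
  obtain ⟨h1, e0, e1, e2, e3, e4, e5, e6⟩ := h
  have h2 : τ ^ 2 * s ^ 2 = 1 := by rw [← mul_pow, h1, one_pow]
  have h4 : τ ^ 4 * s ^ 4 = 1 := by rw [← mul_pow, h1, one_pow]
  have h3 : τ ^ 3 * s ^ 3 = 1 := by rw [← mul_pow, h1, one_pow]
  have a1 : f 2 ^ 2 - 2 * f 1 * f 3 - 4 * f 0 * f 4
      = u ^ 2 * (g 2 ^ 2 - 2 * g 1 * g 3 - 4 * g 0 * g 4) := by
    rw [e0, e1, e2, e3, e4]
    linear_combination (-2 * u ^ 2 * g 1 * g 3) * h1 - 4 * u ^ 2 * g 0 * g 4 * h2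
  have a2 : f 2 ^ 3 - 3 * (f 1 * f 3 + 2 * f 0 * f 4) * f 2 - 6 * f 0 * f 3 ^ 2
      = u ^ 3 * (g 2 ^ 3 - 3 * (g 1 * g 3 + 2 * g 0 * g 4) * g 2 - 6 * g 0 * g 3 ^ 2) := by
    rw [e0, e1, e2, e3, e4]
    linear_combination (-3 * u ^ 3 * g 1 * g 3 * g 2) * h1
      + (-6 * u ^ 3 * g 0 * g 4 * g 2 - 6 * u ^ 3 * g 0 * g 3 ^ 2) * h2
  have a3 : 4 * f 1 ^ 2 * f 4
        + (3 * f 3 ^ 2 + 10 * f 2 * f 4 + 14 * f 1 * f 5 + 4 * f 0 * f 6) * f 0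
      = u ^ 3 * (4 * g 1 ^ 2 * g 4
        + (3 * g 3 ^ 2 + 10 * g 2 * g 4 + 14 * g 1 * g 5 + 4 * g 0 * g 6) * g 0) := by
    rw [e0, e1, e2, e3, e4, e5, e6]
    linear_combination (u ^ 3 * (4 * g 1 ^ 2 * g 4 + (3 * g 3 ^ 2 + 10 * g 2 * g 4) * g 0)) * h2
      + (14 * u ^ 3 * g 1 * g 5 * g 0) * h3 + (4 * u ^ 3 * g 0 ^ 2 * g 6) * h4
  rw [Ett, a1, a2, a3, sub_eq_add_neg, ← neg_smul]
  -- Both sides now have the same monomials; what remains is to match their real coefficients.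
  refine congrArg₂ _ (congrArg₂ _ (congrArg₂ _ (congrArg _ ?_) (congrArg₂ _ ?_ rfl))
    (congrArg₂ _ ?_ rfl)) (congrArg₂ _ ?_ rfl) <;> simp only [q₀, q₁, q₂, q₃] <;> ring

theorem Err_of_isRescaled (M : Couplings) (R₀ : ℝ) {u τ s : A} {f g : ℕ → A}
    (h : IsRescaled u τ s f g) :
    Err M R₀ f = algebraMap ℝ A (q₀ M R₀)
      + q₁ M R₀ • (u ^ 2 * (g 2 ^ 2 - 2 * g 1 * g 3))
      + q₂ M R₀ • (u ^ 3 * (g 2 ^ 3 - 3 * g 1 * g 2 * g 3))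
      + q₃ M R₀ • (u ^ 3 * (4 * g 1 ^ 2 * g 4
          + (g 3 ^ 2 - 2 * g 2 * g 4 + 2 * g 1 * g 5) * g 0)) := by
  obtain ⟨h1, e0, e1, e2, e3, e4, e5, -⟩ := h
  have h2 : τ ^ 2 * s ^ 2 = 1 := by rw [← mul_pow, h1, one_pow]
  have h3 : τ ^ 3 * s ^ 3 = 1 := by rw [← mul_pow, h1, one_pow]
  have a1 : f 2 ^ 2 - 2 * f 1 * f 3 = u ^ 2 * (g 2 ^ 2 - 2 * g 1 * g 3) := by
    rw [e1, e2, e3]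
    linear_combination (-2 * u ^ 2 * g 1 * g 3) * h1
  have a2 : f 2 ^ 3 - 3 * f 1 * f 2 * f 3 = u ^ 3 * (g 2 ^ 3 - 3 * g 1 * g 2 * g 3) := by
    rw [e1, e2, e3]
    linear_combination (-3 * u ^ 3 * g 1 * g 3 * g 2) * h1
  have a3 : 4 * f 1 ^ 2 * f 4 + (f 3 ^ 2 - 2 * f 2 * f 4 + 2 * f 1 * f 5) * f 0
      = u ^ 3 * (4 * g 1 ^ 2 * g 4 + (g 3 ^ 2 - 2 * g 2 * g 4 + 2 * g 1 * g 5) * g 0) := by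
    rw [e0, e1, e2, e3, e4, e5]
    linear_combination (u ^ 3 * (4 * g 1 ^ 2 * g 4 + (g 3 ^ 2 - 2 * g 2 * g 4) * g 0)) * h2
      + (2 * u ^ 3 * g 1 * g 5 * g 0) * h3
  rw [Err, a1, a2, a3, sub_eq_add_neg, ← neg_smul]
  refine congrArg₂ _ (congrArg₂ _ (congrArg₂ _ (congrArg _ ?_) (congrArg₂ _ ?_ rfl))
    (congrArg₂ _ ?_ rfl)) (congrArg₂ _ ?_ rfl) <;> simp only [q₀, q₁, q₂, q₃] <;> ring

theorem Eθθ_of_isRescaled (M : Couplings) (R₀ : ℝ) {u τ s : A} {f g : ℕ → A}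
    (h : IsRescaled u τ s f g) :
    Eθθ M R₀ f = algebraMap ℝ A (σ₀ M R₀)
      + σ₁ M R₀ • (u * g 2)
      + σ₂ M R₀ • (u ^ 2 * g 2 ^ 2)
      + σ₃ M R₀ • (u ^ 2 * (g 1 * g 3 + g 0 * g 4))
      + σ₄ M R₀ • (u ^ 3 * g 2 ^ 3)
      + σ₅ M R₀ • (u ^ 3 * (g 0 * g 3 ^ 2))
      + σ₆ M R₀ • (u ^ 3 * (g 0 * g 3 ^ 2 + (g 1 * g 3 + g 0 * g 4) * g 2))
      + σ₇ M R₀ • (u ^ 3 * (2 * g 1 ^ 2 * g 4 + (g 2 * g 3 + 4 * g 0 * g 5) * g 1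
          + (3 * g 2 * g 4 + g 0 * g 6) * g 0)) := by
  obtain ⟨h1, e0, e1, e2, e3, e4, e5, e6⟩ := h
  have h2 : τ ^ 2 * s ^ 2 = 1 := by rw [← mul_pow, h1, one_pow]
  have h4 : τ ^ 4 * s ^ 4 = 1 := by rw [← mul_pow, h1, one_pow]
  have h3 : τ ^ 3 * s ^ 3 = 1 := by rw [← mul_pow, h1, one_pow]
  have a1 : f 1 * f 3 + f 0 * f 4 = u ^ 2 * (g 1 * g 3 + g 0 * g 4) := by
    rw [e0, e1, e3, e4]
    linear_combination (u ^ 2 * g 1 * g 3) * h1 + u ^ 2 * g 0 * g 4 * h2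
  have a2 : f 0 * f 3 ^ 2 = u ^ 3 * (g 0 * g 3 ^ 2) := by
    rw [e0, e3]
    linear_combination (u ^ 3 * g 0 * g 3 ^ 2) * h2
  have a3 : f 0 * f 3 ^ 2 + (f 1 * f 3 + f 0 * f 4) * f 2
      = u ^ 3 * (g 0 * g 3 ^ 2 + (g 1 * g 3 + g 0 * g 4) * g 2) := by
    rw [a1, a2, e2]
    ring
  have a4 : 2 * f 1 ^ 2 * f 4 + (f 2 * f 3 + 4 * f 0 * f 5) * f 1
        + (3 * f 2 * f 4 + f 0 * f 6) * f 0
      = u ^ 3 * (2 * g 1 ^ 2 * g 4 + (g 2 * g 3 + 4 * g 0 * g 5) * g 1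
          + (3 * g 2 * g 4 + g 0 * g 6) * g 0) := by
    rw [e0, e1, e2, e3, e4, e5, e6]
    linear_combination (u ^ 3 * (2 * g 1 ^ 2 * g 4 + 3 * g 2 * g 4 * g 0)) * h2
      + (u ^ 3 * g 1 * g 2 * g 3) * h1
      + (4 * u ^ 3 * g 1 * g 5 * g 0) * h3 + (u ^ 3 * g 0 ^ 2 * g 6) * h4
  rw [Eθθ, a3, a4, a1, a2, e2, mul_pow, mul_pow]
  simp only [sub_eq_add_neg, ← neg_smul]
  refine congrArg₂ _ (congrArg₂ _ (congrArg₂ _ (congrArg₂ _ (congrArg₂ _ (congrArg₂ _ (congrArg₂ _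
    (congrArg _ ?_) (congrArg₂ _ ?_ rfl)) (congrArg₂ _ ?_ rfl)) (congrArg₂ _ ?_ rfl))
    (congrArg₂ _ ?_ rfl)) (congrArg₂ _ ?_ rfl)) (congrArg₂ _ ?_ rfl)) (congrArg₂ _ ?_ rfl) <;>
    simp only [σ₀, σ₁, σ₂, σ₃, σ₄, σ₅, σ₆, σ₇] <;> ring

end Scaling

/-! ### Abstract limits and the indicial equations -/

/-- `L x c` behaves like the statement that `x` has the limit `c` when the expansion variable tends
to `0`, and `T x` like the `x`-th power of that variable. -/
structure IsLimitRelation {A : Type*} [CommRing A] [Algebra ℝ A] (L : A → ℝ → Prop)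
    (T : ℝ → A) : Prop where
  const : ∀ c, L (algebraMap ℝ A c) c
  add : ∀ {x y c d}, L x c → L y d → L (x + y) (c + d)
  mul : ∀ {x y c d}, L x c → L y d → L (x * y) (c * d)
  unique : ∀ {x c d}, L x c → L x d → c = d
  T_zero : T 0 = 1
  T_add : ∀ x y, T (x + y) = T x * T y
  T_pos : ∀ {x}, 0 < x → L (T x) 0

/-- `n (n - 1) ⋯ (n - k + 1)`. -/
noncomputable def falling (n : ℝ) (k : ℕ) : ℝ := ∏ i ∈ Finset.range k, (n - i)

namespace IsLimitRelation

variable {A : Type*} [CommRing A] [Algebra ℝ A] {L : A → ℝ → Prop} {T : ℝ → A}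

omit [CommRing A] [Algebra ℝ A] in
theorem of_eq {x : A} {c d : ℝ} (hx : L x c) (h : c = d) : L x d := h ▸ hx

theorem smul (hL : IsLimitRelation L T) (r : ℝ) {x : A} {c : ℝ} (hx : L x c) :
    L (r • x) (r * c) := by
  rw [Algebra.smul_def]
  exact hL.mul (hL.const r) hx

theorem pow (hL : IsLimitRelation L T) {x : A} {c : ℝ} (hx : L x c) (k : ℕ) :
    L (x ^ k) (c ^ k) := by
  induction k with
  | zero => simpa using hL.const 1
  | succ k ih => rw [pow_succ, pow_succ]; exact hL.mul ih hx

theorem sub (hL : IsLimitRelation L T) {x y : A} {c d : ℝ} (hx : L x c) (hy : L y d) :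
    L (x - y) (c - d) := by
  have := hL.add hx (hL.smul (-1) hy)
  rw [neg_one_smul, ← sub_eq_add_neg] at this
  exact of_eq this (by ring)

theorem ofNat_mul (hL : IsLimitRelation L T) (m : ℕ) [m.AtLeastTwo] {x : A} {c : ℝ}
    (hx : L x c) : L (OfNat.ofNat m * x) (OfNat.ofNat m * c) := by
  have := hL.mul (hL.const (OfNat.ofNat m)) hx
  rwa [map_ofNat] at this

/-- The weight `Δ^(n-k)` of the `k`-th derivative splits as `Δ^(n-2) * Δ^(2-k)`, hence `u = T (n -
2)` and `τ = T 1`. -/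
theorem isRescaled (hL : IsLimitRelation L T) (n : ℝ) (g : ℕ → A) :
    IsRescaled (T (n - 2)) (T 1) (T (-1)) (fun k => T (n - k) * g k) g := by
  have hT : ∀ x y z, x + y = z → T z = T x * T y := fun x y z h => by rw [← h, hL.T_add]
  have h2 : T 2 = T 1 ^ 2 := by rw [hT 1 1 2 (by norm_num), sq]
  have m2 : T (-2) = T (-1) ^ 2 := by rw [hT (-1) (-1) (-2) (by norm_num), sq]
  have m3 : T (-3) = T (-1) ^ 3 := by rw [hT (-2) (-1) (-3) (by norm_num), m2]; ring
  have m4 : T (-4) = T (-1) ^ 4 := by rw [hT (-3) (-1) (-4) (by norm_num), m3]; ring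
  refine ⟨?_, ?_, ?_, ?_, ?_, ?_, ?_, ?_⟩
  · rw [← hL.T_add, add_neg_cancel, hL.T_zero]
  · simp only [← h2, ← hL.T_add]; norm_num
  · simp only [← hL.T_add]; congr 2; push_cast; ring
  · simp
  · simp only [← hL.T_add]; congr 2; push_cast; ring
  · simp only [← m2, ← hL.T_add]; congr 2; push_cast; ring
  · simp only [← m3, ← hL.T_add]; congr 2; push_cast; ring
  · simp only [← m4, ← hL.T_add]; congr 2; push_cast; ring

/-- The limits of the homogeneous parts of the field equations at the leading order. -/
theorem limits (hL : IsLimitRelation L T) (M : Couplings) (R₀ n a₀ : ℝ) (g : ℕ → A)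
    (hg : ∀ k, L (g k) (a₀ * falling n k)) :
    ∃ P Q S₁ S₂ S₃ : A,
      L P (a₀ ^ 2 * (n ^ 2 * (n - 1) * (3 - n))) ∧
      L Q (-(a₀ ^ 3 * (n ^ 2 * (n - 1))) * (q₂ M R₀ * n * (n - 1) * (2 * n - 5)
        - q₃ M R₀ * (n - 2) * (5 * n ^ 2 - 21 * n + 20))) ∧
      L S₁ (a₀ * (n * (n - 1))) ∧
      L S₂ (a₀ ^ 2 * (n * (n - 1)) * (n * (n - 1) * σ₂ M R₀ + (n - 2) * (2 * n - 3) * σ₃ M R₀)) ∧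
      L S₃ (a₀ ^ 3 * (n * (n - 1)) * (n * (n - 1) * (n * (n - 1) * σ₄ M R₀
          + (n - 2) * ((n - 2) * σ₅ M R₀ + σ₆ M R₀ * (3 * n - 5)))
        + σ₇ M R₀ * (n - 2) ^ 3 * (11 * n - 15))) ∧
      Err M R₀ (fun k => T (n - k) * g k) = algebraMap ℝ A (q₀ M R₀)
        + T (n - 2) ^ 2 * (q₁ M R₀ • P) + T (n - 2) ^ 3 * Q ∧
      Eθθ M R₀ (fun k => T (n - k) * g k) = algebraMap ℝ A (σ₀ M R₀)
        + T (n - 2) * (σ₁ M R₀ • S₁) + T (n - 2) ^ 2 * S₂ + T (n - 2) ^ 3 * S₃ := by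
  have h0 : L (g 0) a₀ := of_eq (hg 0) (by simp [falling])
  have h1 : L (g 1) (a₀ * n) := of_eq (hg 1) (by simp [falling])
  have h2 : L (g 2) (a₀ * (n * (n - 1))) :=
    of_eq (hg 2) (by simp [falling, Finset.prod_range_succ])
  have h3 : L (g 3) (a₀ * (n * (n - 1) * (n - 2))) :=
    of_eq (hg 3) (by simp [falling, Finset.prod_range_succ])
  have h4 : L (g 4) (a₀ * (n * (n - 1) * (n - 2) * (n - 3))) :=
    of_eq (hg 4) (by simp [falling, Finset.prod_range_succ])
  have h5 : L (g 5) (a₀ * (n * (n - 1) * (n - 2) * (n - 3) * (n - 4))) :=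
    of_eq (hg 5) (by simp [falling, Finset.prod_range_succ])
  have h6 : L (g 6) (a₀ * (n * (n - 1) * (n - 2) * (n - 3) * (n - 4) * (n - 5))) :=
    of_eq (hg 6) (by simp [falling, Finset.prod_range_succ])
  refine ⟨g 2 ^ 2 - 2 * (g 1 * g 3),
    q₂ M R₀ • (g 2 ^ 3 - 3 * (g 1 * g 2 * g 3))
      + q₃ M R₀ • (4 * (g 1 ^ 2 * g 4) + (g 3 ^ 2 - 2 * (g 2 * g 4) + 2 * (g 1 * g 5)) * g 0),
    g 2, σ₂ M R₀ • g 2 ^ 2 + σ₃ M R₀ • (g 1 * g 3 + g 0 * g 4),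
    σ₄ M R₀ • g 2 ^ 3 + σ₅ M R₀ • (g 0 * g 3 ^ 2)
      + σ₆ M R₀ • (g 0 * g 3 ^ 2 + (g 1 * g 3 + g 0 * g 4) * g 2)
      + σ₇ M R₀ • (2 * (g 1 ^ 2 * g 4) + (g 2 * g 3 + 4 * (g 0 * g 5)) * g 1
          + (3 * (g 2 * g 4) + g 0 * g 6) * g 0), ?_, ?_, ?_, ?_, ?_, ?_, ?_⟩
  -- The factor `3 - n` arises as `(n - 1) - 2 (n - 2)`; its zero is what makes `n = 3` exceptional.
  · refine of_eq (hL.sub (hL.pow h2 2) (hL.ofNat_mul 2 (hL.mul h1 h3))) ?_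
    ring
  · refine of_eq (hL.add
      (hL.smul _ (hL.sub (hL.pow h2 3) (hL.ofNat_mul 3 (hL.mul (hL.mul h1 h2) h3))))
      (hL.smul _ (hL.add (hL.ofNat_mul 4 (hL.mul (hL.pow h1 2) h4))
        (hL.mul (hL.add (hL.sub (hL.pow h3 2) (hL.ofNat_mul 2 (hL.mul h2 h4)))
          (hL.ofNat_mul 2 (hL.mul h1 h5))) h0)))) ?_
    ring
  · exact h2
  · refine of_eq (hL.add (hL.smul _ (hL.pow h2 2))
      (hL.smul _ (hL.add (hL.mul h1 h3) (hL.mul h0 h4)))) ?_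
    ring
  · refine of_eq (hL.add (hL.add (hL.add (hL.smul _ (hL.pow h2 3))
      (hL.smul _ (hL.mul h0 (hL.pow h3 2))))
      (hL.smul _ (hL.add (hL.mul h0 (hL.pow h3 2))
        (hL.mul (hL.add (hL.mul h1 h3) (hL.mul h0 h4)) h2))))
      (hL.smul _ (hL.add (hL.add (hL.ofNat_mul 2 (hL.mul (hL.pow h1 2) h4))
        (hL.mul (hL.add (hL.mul h2 h3) (hL.ofNat_mul 4 (hL.mul h0 h5))) h1))
        (hL.mul (hL.add (hL.ofNat_mul 3 (hL.mul h2 h4)) (hL.mul h0 h6)) h0)))) ?_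
    ring
  · rw [Err_of_isRescaled M R₀ (hL.isRescaled n g)]
    simp only [Algebra.smul_def]
    ring
  · rw [Eθθ_of_isRescaled M R₀ (hL.isRescaled n g)]
    simp only [Algebra.smul_def]
    ring

/-- The indicial equations, for every notion of limit. -/
theorem exists_inClass (hL : IsLimitRelation L T) (M : Couplings) (R₀ n a₀ : ℝ) (ha : a₀ ≠ 0)
    (g : ℕ → A) (hg : ∀ k, L (g k) (a₀ * falling n k))
    (hr : ∀ x, L (T x * Err M R₀ (fun k => T (n - k) * g k)) 0)
    (hθ : ∀ x, L (T x * Eθθ M R₀ (fun k => T (n - k) * g k)) 0) :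
    ∃ K : IndicialClass, InClass M R₀ n a₀ K := by
  obtain ⟨P, Q, S₁, S₂, S₃, hP', hQ, h₁', h₂, h₃, er, eθ⟩ := hL.limits M R₀ n a₀ g hg
  have hP := hL.smul (q₁ M R₀) hP'
  have h₁ := hL.smul (σ₁ M R₀) h₁'
  have hr0 := hr 0
  have hθ0 := hθ 0
  rw [hL.T_zero, one_mul, er] at hr0
  rw [hL.T_zero, one_mul, eθ] at hθ0
  -- Multiplying an equation by powers of `T (2 - n)` divides it by powers of `u = T (n - 2)`.
  have huv : T (n - 2) * T (2 - n) = 1 := by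
    rw [← hL.T_add]
    simp [hL.T_zero]
  -- Classes 3a and 3b carry no further condition; away from them the factors `n` and `n - 1` of the
  -- limits can be cancelled.
  by_cases hn1 : n = 1
  · exact ⟨.c3a, hn1⟩
  by_cases hn0 : n = 0
  · exact ⟨.c3b, hn0⟩
  have hn1' : n - 1 ≠ 0 := sub_ne_zero.2 hn1
  have v2 : T (2 * (2 - n)) = T (2 - n) ^ 2 := by rw [two_mul, hL.T_add, sq]
  have v3 : T (3 * (2 - n)) = T (2 - n) ^ 3 := by
    rw [show 3 * (2 - n) = 2 * (2 - n) + (2 - n) by ring, hL.T_add, v2]; ring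
  rcases lt_trichotomy n 2 with hn | hn | hn
  -- For `n < 2`, division by `u ^ 3` leaves the lower degrees with positive powers of `T (2 - n)`,
  -- so the limits of `Q` and `S₃` must vanish.
  · have hv : L (T (2 - n)) 0 := hL.T_pos (by linarith)
    have hr3 := hr (3 * (2 - n))
    have hθ3 := hθ (3 * (2 - n))
    rw [er, v3, show T (2 - n) ^ 3 * (algebraMap ℝ A (q₀ M R₀) + T (n - 2) ^ 2 * (q₁ M R₀ • P)
      + T (n - 2) ^ 3 * Q) = T (2 - n) ^ 3 * algebraMap ℝ A (q₀ M R₀) + T (2 - n) * (q₁ M R₀ • P) + Q by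
        linear_combination (T (2 - n) * (q₁ M R₀ • P) * (T (n - 2) * T (2 - n) + 1)
          + Q * ((T (n - 2) * T (2 - n)) ^ 2 + T (n - 2) * T (2 - n) + 1)) * huv] at hr3
    rw [eθ, v3, show T (2 - n) ^ 3 * (algebraMap ℝ A (σ₀ M R₀) + T (n - 2) * (σ₁ M R₀ • S₁)
      + T (n - 2) ^ 2 * S₂ + T (n - 2) ^ 3 * S₃) = T (2 - n) ^ 3 * algebraMap ℝ A (σ₀ M R₀)
      + T (2 - n) ^ 2 * (σ₁ M R₀ • S₁) + T (2 - n) * S₂ + S₃ by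
        linear_combination (T (2 - n) ^ 2 * (σ₁ M R₀ • S₁) + T (2 - n) * S₂ * (T (n - 2) * T (2 - n) + 1)
          + S₃ * ((T (n - 2) * T (2 - n)) ^ 2 + T (n - 2) * T (2 - n) + 1)) * huv] at hθ3
    have k1 := hL.unique hr3
      (hL.add (hL.add (hL.mul (hL.pow hv 3) (hL.const _)) (hL.mul hv hP)) hQ)
    have k2 := hL.unique hθ3 (hL.add (hL.add (hL.add (hL.mul (hL.pow hv 3) (hL.const _))
      (hL.mul (hL.pow hv 2) h₁)) (hL.mul hv h₂)) h₃)
    refine ⟨.c3c, hn, ?_, ?_⟩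
    · refine (mul_eq_zero.1 (show -(a₀ ^ 3 * (n ^ 2 * (n - 1))) * _ = 0 by
        linear_combination -k1)).resolve_left ?_
      simp [ha, hn0, hn1']
    · refine (mul_eq_zero.1 (show a₀ ^ 3 * (n * (n - 1)) * _ = 0 by
        linear_combination -k2)).resolve_left ?_
      simp [ha, hn0, hn1']
  · subst hn
    simp only [sub_self, hL.T_zero, one_pow, one_mul] at hr0 hθ0
    have k1 := hL.unique hr0 (hL.add (hL.add (hL.const _) hP) hQ)
    have k2 := hL.unique hθ0 (hL.add (hL.add (hL.add (hL.const _) h₁) h₂) h₃)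
    exact ⟨.c2, rfl, by linear_combination -k1, by linear_combination -k2⟩
  -- For `n > 2`, `u` tends to `0`: the lowest remaining degree must vanish, and dividing by `u`
  -- exposes the next one.
  · have hu : L (T (n - 2)) 0 := hL.T_pos (by linarith)
    have k1 : q₀ M R₀ = 0 := by
      have := hL.unique hr0 (hL.add (hL.add (hL.const _) (hL.mul (hL.pow hu 2) hP))
        (hL.mul (hL.pow hu 3) hQ))
      linear_combination -this
    have k2 : σ₀ M R₀ = 0 := by
      have := hL.unique hθ0 (hL.add (hL.add (hL.add (hL.const _) (hL.mul hu h₁))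
        (hL.mul (hL.pow hu 2) h₂)) (hL.mul (hL.pow hu 3) h₃))
      linear_combination -this
    have k3 : σ₁ M R₀ = 0 := by
      have hθ1 := hθ (2 - n)
      rw [eθ, k2, map_zero, show T (2 - n) * (0 + T (n - 2) * (σ₁ M R₀ • S₁)
        + T (n - 2) ^ 2 * S₂ + T (n - 2) ^ 3 * S₃) = σ₁ M R₀ • S₁ + T (n - 2) * S₂ + T (n - 2) ^ 2 * S₃ by
          linear_combination (σ₁ M R₀ • S₁ + T (n - 2) * S₂ + T (n - 2) ^ 2 * S₃) * huv] at hθ1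
      have := hL.unique hθ1 (hL.add (hL.add h₁ (hL.mul hu h₂)) (hL.mul (hL.pow hu 2) h₃))
      refine (mul_eq_zero.1 (show a₀ * (n * (n - 1)) * _ = 0 by
        linear_combination -this)).resolve_left ?_
      simp [ha, hn0, hn1']
    have k4 : (3 - n) * q₁ M R₀ = 0 := by
      have hr2 := hr (2 * (2 - n))
      rw [er, v2, k1, map_zero, show T (2 - n) ^ 2 * (0 + T (n - 2) ^ 2 * (q₁ M R₀ • P)
        + T (n - 2) ^ 3 * Q) = q₁ M R₀ • P + T (n - 2) * Q by
          linear_combination (q₁ M R₀ • P + T (n - 2) * Q) * (T (n - 2) * T (2 - n) + 1) * huv] at hr2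
      have := hL.unique hr2 (hL.add hP (hL.mul hu hQ))
      refine (mul_eq_zero.1 (show a₀ ^ 2 * (n ^ 2 * (n - 1)) * _ = 0 by
        linear_combination -this)).resolve_left ?_
      simp [ha, hn0, hn1']
    have k5 : n * (n - 1) * σ₂ M R₀ + (n - 2) * (2 * n - 3) * σ₃ M R₀ = 0 := by
      have hθ2 := hθ (2 * (2 - n))
      rw [eθ, v2, k2, k3, map_zero, zero_smul, show T (2 - n) ^ 2 * (0 + T (n - 2) * 0
        + T (n - 2) ^ 2 * S₂ + T (n - 2) ^ 3 * S₃) = S₂ + T (n - 2) * S₃ by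
          linear_combination (S₂ + T (n - 2) * S₃) * (T (n - 2) * T (2 - n) + 1) * huv] at hθ2
      have := hL.unique hθ2 (hL.add h₂ (hL.mul hu h₃))
      refine (mul_eq_zero.1 (show a₀ ^ 2 * (n * (n - 1)) * _ = 0 by
        linear_combination -this)).resolve_left ?_
      simp [ha, hn0, hn1']
    -- At `n = 3` the relation `k4` is void and `q₁` stays free; otherwise it forces `q₁ = 0`.
    by_cases hn3 : n = 3
    · subst hn3
      exact ⟨.c1a, rfl, k1, k2, k3, by linear_combination k5 / 3⟩
    have k6 : q₁ M R₀ = 0 := (mul_eq_zero.1 k4).resolve_left (sub_ne_zero.2 (Ne.symm hn3))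
    refine ⟨.c1b, hn, k1, k6, k2, k3, k5, ?_⟩
    -- With `q₀ = q₁ = 0` the `rr` equation is exactly `u ^ 3 * Q`. The `θθ` equation gives no such
    -- condition here, since corrections to `S₂` may compete with `S₃`.
    have hr3 := hr (3 * (2 - n))
    rw [er, v3, k1, k6, map_zero, zero_smul, show T (2 - n) ^ 3 * (0 + T (n - 2) ^ 2 * 0
      + T (n - 2) ^ 3 * Q) = Q by
        linear_combination Q * ((T (n - 2) * T (2 - n)) ^ 2 + T (n - 2) * T (2 - n) + 1) * huv]
      at hr3
    have := hL.unique hr3 hQ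
    refine (mul_eq_zero.1 (show -(a₀ ^ 3 * (n ^ 2 * (n - 1))) * _ = 0 by
      linear_combination -this)).resolve_left ?_
    simp [ha, hn0, hn1']

end IsLimitRelation

theorem falling_succ (n : ℝ) (k : ℕ) : falling n (k + 1) = falling n k * (n - k) :=
  Finset.prod_range_succ _ _

/-! ### Formal series -/

/-- Real exponents make the support explicit: either the exponent is not a natural number and the
coefficient vanishes, or the coefficient is that of the power series. -/
theorem coeff_ofPowerSeries_mk (b : ℕ → ℝ) (x : ℝ) :
    (∀ i : ℕ, x ≠ i) ∧ (HahnSeries.ofPowerSeries ℝ ℝ (PowerSeries.mk b)).coeff x = 0 ∨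
      ∃ i : ℕ, x = i ∧ (HahnSeries.ofPowerSeries ℝ ℝ (PowerSeries.mk b)).coeff x = b i := by
  by_cases h : ∃ i : ℕ, x = i
  · obtain ⟨i, rfl⟩ := h
    exact Or.inr ⟨i, rfl, by simp [HahnSeries.ofPowerSeries_apply_coeff]⟩
  · push Not at h
    refine Or.inl ⟨h, ?_⟩
    rw [HahnSeries.ofPowerSeries_apply]
    refine HahnSeries.embDomain_of_notMem_range ?_
    rintro ⟨i, hi⟩
    exact h i hi.symm

theorem formalDeriv_frobenius (n : ℝ) (b : ℕ → ℝ) :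
    formalDeriv (frobenius n b) = frobenius (n - 1) (fun i => (n + i) * b i) := by
  ext x
  change (x + 1) * (frobenius n b).coeff (x + 1) = _
  rw [frobenius, frobenius, HahnSeries.coeff_single_mul, HahnSeries.coeff_single_mul, one_mul,
    one_mul, show x + 1 - n = x - (n - 1) by ring]
  rcases coeff_ofPowerSeries_mk b (x - (n - 1)) with ⟨h, e⟩ | ⟨i, h, e⟩
  · rcases coeff_ofPowerSeries_mk (fun i => (n + i) * b i) (x - (n - 1)) with ⟨-, e'⟩ | ⟨j, h', -⟩
    · rw [e, e', mul_zero]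
    · exact absurd h' (h j)
  · rcases coeff_ofPowerSeries_mk (fun i => (n + i) * b i) (x - (n - 1)) with ⟨h', -⟩ | ⟨j, h', e'⟩
    · exact absurd h (h' i)
    · obtain rfl : i = j := Nat.cast_injective (h.symm.trans h')
      rw [e, e']
      linear_combination b i * h

/-- Differentiation preserves the Frobenius shape, so the factor next to `Δ^(n-k)` has constant term
`a 0 * falling n k`. -/
theorem formalJet_frobenius (n : ℝ) (a : ℕ → ℝ) (k : ℕ) :
    formalJet (frobenius n a) k = frobenius (n - k) (fun i => a i * falling (n + i) k) := by
  induction k with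
  | zero => simp [formalJet, falling]
  | succ k ih =>
    rw [formalJet, Function.iterate_succ_apply', ← formalJet, ih, formalDeriv_frobenius]
    congr 1
    · push_cast; ring
    · funext i
      rw [falling_succ]
      ring

/-- No negative exponents, and constant coefficient `c`. -/
def HasConstantTerm (x : HahnSeries ℝ ℝ) (c : ℝ) : Prop :=
  (∀ y < 0, x.coeff y = 0) ∧ x.coeff 0 = c

theorem hasConstantTerm_single {x : ℝ} (hx : 0 < x) :
    HasConstantTerm (HahnSeries.single x 1) 0 :=
  ⟨fun _ hy => HahnSeries.coeff_single_of_ne (hy.trans hx).ne,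
    HahnSeries.coeff_single_of_ne hx.ne⟩

/-- Without negative exponents, only the pair `(0, 0)` can contribute to the coefficient at `0` of a
product. -/
theorem HasConstantTerm.mul {x y : HahnSeries ℝ ℝ} {c d : ℝ} (hx : HasConstantTerm x c)
    (hy : HasConstantTerm y d) : HasConstantTerm (x * y) (c * d) := by
  have nonneg : ∀ {z : HahnSeries ℝ ℝ} {e : ℝ}, HasConstantTerm z e → ∀ i ∈ z.support, 0 ≤ i :=
    fun h i hi => not_lt.1 fun hlt => hi (h.1 i hlt)
  refine ⟨fun z hz => ?_, ?_⟩
  · rw [HahnSeries.coeff_mul]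
    refine Finset.sum_eq_zero fun ij hij => ?_
    obtain ⟨h1, h2, h3⟩ := Finset.mem_antidiagonal.1 hij
    have := nonneg hx _ h1
    have := nonneg hy _ h2
    linarith
  · rw [HahnSeries.coeff_mul, Finset.sum_eq_single (0, 0)]
    · rw [hx.2, hy.2]
    · rintro ⟨i, j⟩ hij hne
      obtain ⟨h1, h2, h3⟩ := Finset.mem_antidiagonal.1 hij
      have := nonneg hx _ h1
      have := nonneg hy _ h2
      simp only at *
      refine absurd (Prod.ext ?_ ?_) hne <;> simp only <;> linarith
    · intro h
      rw [Finset.mem_antidiagonal] at h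
      by_contra h'
      exact h ⟨left_ne_zero_of_mul h', right_ne_zero_of_mul h', add_zero 0⟩

theorem isLimitRelation_hasConstantTerm :
    IsLimitRelation HasConstantTerm (fun x => HahnSeries.single x (1 : ℝ)) where
  const c := by
    rw [HahnSeries.algebraMap_apply', PowerSeries.algebraMap_apply, Algebra.algebraMap_self_apply,
      HahnSeries.ofPowerSeries_C, HahnSeries.C_apply]
    exact ⟨fun y hy => HahnSeries.coeff_single_of_ne hy.ne, HahnSeries.coeff_single_same _ _⟩
  add hx hy := ⟨fun z hz => by rw [HahnSeries.coeff_add, hx.1 z hz, hy.1 z hz, add_zero],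
    by rw [HahnSeries.coeff_add, hx.2, hy.2]⟩
  mul hx hy := hx.mul hy
  unique hx hy := hx.2.symm.trans hy.2
  T_zero := rfl
  T_add x y := by rw [HahnSeries.single_mul_single, one_mul]
  T_pos := hasConstantTerm_single

theorem exists_inClass_of_formal (M : Couplings) (R₀ n : ℝ) (a : ℕ → ℝ) (ha : a 0 ≠ 0)
    (hr : Err M R₀ (formalJet (frobenius n a)) = 0)
    (hθ : Eθθ M R₀ (formalJet (frobenius n a)) = 0) :
    ∃ K : IndicialClass, InClass M R₀ n (a 0) K := by
  have e : formalJet (frobenius n a) = fun k : ℕ => HahnSeries.single (n - k) (1 : ℝ) *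
      HahnSeries.ofPowerSeries ℝ ℝ (PowerSeries.mk fun i => a i * falling (n + i) k) :=
    funext fun k => formalJet_frobenius n a k
  rw [e] at hr hθ
  have zero : HasConstantTerm 0 0 := ⟨fun _ _ => rfl, rfl⟩
  refine isLimitRelation_hasConstantTerm.exists_inClass M R₀ n (a 0) ha
    (fun k => HahnSeries.ofPowerSeries ℝ ℝ (PowerSeries.mk fun i => a i * falling (n + i) k))
    (fun k => ⟨fun y hy => ?_, ?_⟩) (fun x => ?_) (fun x => ?_)
  · rcases coeff_ofPowerSeries_mk (fun i => a i * falling (n + i) k) y with ⟨-, e⟩ | ⟨i, rfl, -⟩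
    · exact e
    · exact absurd hy (not_lt.2 i.cast_nonneg)
  · rcases coeff_ofPowerSeries_mk (fun i => a i * falling (n + i) k) 0 with ⟨h, -⟩ | ⟨i, h, e⟩
    · simpa using h 0
    · obtain rfl : i = 0 := by exact_mod_cast h.symm
      rw [e]
      simp
  · rw [hr, mul_zero]; exact zero
  · rw [hθ, mul_zero]; exact zero

/-! ### Convergent series -/

/-- The powers of `r - r₀` for `r > r₀`. -/
noncomputable def powerRight (r₀ x : ℝ) : ℝ → ℝ := fun r => if r₀ < r then (r - r₀) ^ x else 1

theorem isLimitRelation_tendsto (r₀ : ℝ) :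
    IsLimitRelation (fun (f : ℝ → ℝ) c => Tendsto f (𝓝[>] r₀) (𝓝 c)) (powerRight r₀) where
  const _ := tendsto_const_nhds
  add := Tendsto.add
  mul := Tendsto.mul
  unique := tendsto_nhds_unique
  -- The value `1` of `powerRight` for `r ≤ r₀` makes this law and `T_add` identities of functions
  -- on all of `ℝ`; the limit from the right does not see it.
  T_zero := by
    funext r
    simp [powerRight]
  T_add x y := by
    funext r
    by_cases h : r₀ < r
    · simp [powerRight, h, Real.rpow_add (sub_pos.2 h)]
    · simp [powerRight, h]
  T_pos {x} hx := by
    have h1 : Tendsto (fun r => (r - r₀) ^ x) (𝓝[>] r₀) (𝓝 0) := by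
      have : ContinuousAt (fun r => (r - r₀) ^ x) r₀ :=
        (Real.continuousAt_rpow_const _ _ (Or.inr hx.le)).comp (f := fun r => r - r₀)
          (by fun_prop)
      simpa [ContinuousAt, Real.zero_rpow hx.ne'] using this.tendsto.mono_left nhdsWithin_le_nhds
    refine h1.congr' ?_
    filter_upwards [self_mem_nhdsWithin] with r hr
    simp [powerRight, show r₀ < r from hr]

/-- Convergence at `ε / 2` makes the terms there tend to `0`, which bounds the radius of convergence
below by `ε / 2`. -/
theorem exists_analyticAt_of_hasSum {a : ℕ → ℝ} {ε : ℝ} (hε : 0 < ε) {F : ℝ → ℝ}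
    (h : ∀ z ∈ Set.Ioo 0 ε, HasSum (fun i => a i * z ^ i) (F z)) :
    ∃ G : ℝ → ℝ, AnalyticAt ℝ G 0 ∧ G 0 = a 0 ∧ ∃ δ > 0, ∀ z ∈ Set.Ioo 0 δ, F z = G z := by
  set p := FormalMultilinearSeries.ofScalars (𝕜 := ℝ) ℝ a with hp
  have hε2 : 0 < ε / 2 := by positivity
  have hrad : ENNReal.ofReal (ε / 2) ≤ p.radius := by
    rw [ENNReal.ofReal]
    refine p.le_radius_of_tendsto (l := 0) ?_
    have := (h (ε / 2) ⟨hε2, by linarith⟩).summable.tendsto_atTop_zero.norm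
    simp only [norm_zero] at this
    refine this.congr fun i => ?_
    simp [hp, abs_of_pos hε, max_eq_left hε2.le]
  have hpos : 0 < p.radius := lt_of_lt_of_le (by simpa using hε2) hrad
  have hb := p.hasFPowerSeriesOnBall hpos
  refine ⟨p.sum, hb.analyticAt, ?_, ε / 2, hε2, fun z hz => ?_⟩
  · have h0 := hb.hasSum (y := 0) (by simpa using hpos)
    simp only [hp, FormalMultilinearSeries.ofScalars_apply_eq, add_zero] at h0
    refine h0.unique ?_
    have := hasSum_single (f := fun i => a i • (0 : ℝ) ^ i) 0 (fun i hi => by simp [hi])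
    simpa only [pow_zero, smul_eq_mul, mul_one] using this
  · have h0 := hb.hasSum (y := z) (by
      rw [Metric.mem_eball, edist_zero_right]
      refine lt_of_lt_of_le ?_ hrad
      rw [← ofReal_norm]
      refine (ENNReal.ofReal_lt_ofReal_iff hε2).2 ?_
      rw [Real.norm_eq_abs, abs_of_pos hz.1]
      exact hz.2)
    simp only [hp, FormalMultilinearSeries.ofScalars_apply_eq, zero_add] at h0
    exact (h z ⟨hz.1, by linarith [hz.2]⟩).unique h0

/-- The derivative of `z^m g(z)` is `z^(m-1) (m g(z) + z g'(z))`; the bracket is analytic with value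
`m g(0)` at `0`. Iterating from `m = n` builds `falling n k`. -/
theorem exists_iteratedDeriv_eq {f G : ℝ → ℝ} {r₀ n : ℝ} (hG : AnalyticAt ℝ G 0)
    (hf : ∃ δ > 0, ∀ r ∈ Set.Ioo r₀ (r₀ + δ), f r = (r - r₀) ^ n * G (r - r₀)) (k : ℕ) :
    ∃ g : ℝ → ℝ, AnalyticAt ℝ g 0 ∧ g 0 = G 0 * falling n k ∧
      ∃ δ > 0, ∀ r ∈ Set.Ioo r₀ (r₀ + δ),
        iteratedDeriv k f r = (r - r₀) ^ (n - k) * g (r - r₀) := by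
  induction k with
  | zero => exact ⟨G, hG, by simp [falling], by simpa using hf⟩
  | succ k ih =>
    obtain ⟨g, hg, hg0, δ, hδ, h⟩ := ih
    obtain ⟨η, hη, hdiff⟩ := Metric.eventually_nhds_iff.1 hg.eventually_analyticAt
    refine ⟨fun z => (n - k) * g z + z * deriv g z, ?_, ?_, min δ η, lt_min hδ hη, fun r hr => ?_⟩
    · exact (analyticAt_const.mul hg).add (analyticAt_id.mul hg.deriv)
    · simp only [hg0, zero_mul, add_zero, falling_succ]
      ring
    · have hpos : 0 < r - r₀ := sub_pos.2 hr.1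
      have h1 : r < r₀ + δ := hr.2.trans_le (by gcongr; exact min_le_left _ _)
      have h2 : r < r₀ + η := hr.2.trans_le (by gcongr; exact min_le_right _ _)
      have hda : DifferentiableAt ℝ g (r - r₀) := by
        refine (hdiff ?_).differentiableAt
        rw [Real.dist_eq, sub_zero, abs_of_pos hpos]
        linarith
      have e : iteratedDeriv k f =ᶠ[𝓝 r] fun r => (r - r₀) ^ (n - k) * g (r - r₀) :=
        Filter.eventually_of_mem (Ioo_mem_nhds hr.1 h1) h
      rw [iteratedDeriv_succ, e.deriv_eq]
      have d1 : HasDerivAt (fun r => r - r₀) 1 r := (hasDerivAt_id r).sub_const r₀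
      have d2 := (d1.rpow_const (p := n - k) (Or.inl hpos.ne')).mul
        (hda.hasDerivAt.comp r d1)
      refine d2.deriv.trans ?_
      have e1 : (r - r₀) ^ (n - k) = (r - r₀) ^ (n - k - 1) * (r - r₀) := by
        rw [← Real.rpow_add_one hpos.ne']; ring_nf
      rw [Nat.cast_succ, show n - ((k : ℝ) + 1) = n - k - 1 by ring]
      simp only [Function.comp_apply, e1]
      ring

theorem HasFrobeniusSeries.exists_analyticAt {f : ℝ → ℝ} {r₀ n : ℝ} {a : ℕ → ℝ}
    (h : HasFrobeniusSeries f r₀ n a) :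
    ∃ G : ℝ → ℝ, AnalyticAt ℝ G 0 ∧ G 0 = a 0 ∧
      ∃ δ > 0, ∀ r ∈ Set.Ioo r₀ (r₀ + δ), f r = (r - r₀) ^ n * G (r - r₀) := by
  obtain ⟨-, ε, hε, hs⟩ := h
  obtain ⟨G, hG, hG0, δ, hδ, e⟩ :=
    exists_analyticAt_of_hasSum (a := a) (F := fun z => z ^ (-n) * f (r₀ + z)) hε (by
      intro z hz
      have := (hs (r₀ + z) ⟨by linarith [hz.1], by linarith [hz.2]⟩).mul_left (z ^ (-n))
      refine this.congr_fun ?_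
      intro i
      simp only [add_sub_cancel_left]
      rw [Real.rpow_add hz.1, Real.rpow_neg hz.1.le, Real.rpow_natCast]
      have := (Real.rpow_pos_of_pos hz.1 n).ne'
      field_simp)
  refine ⟨G, hG, hG0, δ, hδ, fun r hr => ?_⟩
  have hpos : 0 < r - r₀ := sub_pos.2 hr.1
  rw [← e (r - r₀) ⟨hpos, by linarith [hr.2]⟩, add_sub_cancel, ← mul_assoc,
    ← Real.rpow_add hpos, add_neg_cancel, Real.rpow_zero, one_mul]

theorem Err_apply (M : Couplings) (R₀ : ℝ) (F : ℕ → ℝ → ℝ) (r : ℝ) :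
    Err M R₀ F r = Err M R₀ (fun k => F k r) := rfl

theorem Eθθ_apply (M : Couplings) (R₀ : ℝ) (F : ℕ → ℝ → ℝ) (r : ℝ) :
    Eθθ M R₀ F r = Eθθ M R₀ (fun k => F k r) := rfl

/-- Only finitely many derivatives occur. This lets their separate expansions, each valid on its own
interval, hold simultaneously near `r₀`. -/
theorem Err_congr_of_le (M : Couplings) (R₀ : ℝ) {f g : ℕ → ℝ} (h : ∀ k ≤ 6, f k = g k) :
    Err M R₀ f = Err M R₀ g := by
  rw [Err, Err, h 0 (by norm_num), h 1 (by norm_num), h 2 (by norm_num), h 3 (by norm_num),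
    h 4 (by norm_num), h 5 (by norm_num)]

theorem Eθθ_congr_of_le (M : Couplings) (R₀ : ℝ) {f g : ℕ → ℝ} (h : ∀ k ≤ 6, f k = g k) :
    Eθθ M R₀ f = Eθθ M R₀ g := by
  rw [Eθθ, Eθθ, h 0 (by norm_num), h 1 (by norm_num), h 2 (by norm_num), h 3 (by norm_num),
    h 4 (by norm_num), h 5 (by norm_num), h 6 (by norm_num)]

theorem exists_inClass_of_hasFrobeniusSeries (M : Couplings) (R₀ : ℝ) {f : ℝ → ℝ} {r₀ n : ℝ}
    {a : ℕ → ℝ} (h : HasFrobeniusSeries f r₀ n a)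
    (hE : ∀ᶠ r in 𝓝[>] r₀, Err M R₀ (jet f r) = 0 ∧ Eθθ M R₀ (jet f r) = 0) :
    ∃ K : IndicialClass, InClass M R₀ n (a 0) K := by
  obtain ⟨G, hG, hG0, hf⟩ := h.exists_analyticAt
  choose g hg hg0 hgf using exists_iteratedDeriv_eq hG hf
  have key : ∀ k, ∀ᶠ r in 𝓝[>] r₀, jet f r k = (powerRight r₀ (n - k) * fun r => g k (r - r₀)) r := by
    intro k
    obtain ⟨δ, hδ, e⟩ := hgf k
    filter_upwards [Ioo_mem_nhdsGT (show r₀ < r₀ + δ by linarith)] with r hr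
    rw [jet, e r hr]
    simp [powerRight, hr.1]
  have key' : ∀ᶠ r in 𝓝[>] r₀, ∀ k ≤ 6,
      jet f r k = (powerRight r₀ (n - k) * fun r => g k (r - r₀)) r :=
    (Filter.eventually_all_finite (Set.finite_Iic 6)).2 fun k _ => key k
  refine (isLimitRelation_tendsto r₀).exists_inClass M R₀ n (a 0) h.1
    (fun k r => g k (r - r₀)) (fun k => ?_) (fun x => ?_) (fun x => ?_)
  · rw [← hG0, ← hg0]
    have : ContinuousAt (fun r => g k (r - r₀)) r₀ :=
      ContinuousAt.comp (f := fun r => r - r₀) (by simpa using (hg k).continuousAt)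
        (by fun_prop)
    simpa [ContinuousAt] using this.tendsto.mono_left nhdsWithin_le_nhds
  · refine (tendsto_const_nhds (x := (0 : ℝ))).congr' ?_
    filter_upwards [key', hE] with r hr hr0
    rw [Pi.mul_apply, Err_apply, ← Err_congr_of_le M R₀ hr, hr0.1, mul_zero]
  · refine (tendsto_const_nhds (x := (0 : ℝ))).congr' ?_
    filter_upwards [key', hE] with r hr hr0
    rw [Pi.mul_apply, Eθθ_apply, ← Eθθ_congr_of_le M R₀ hr, hr0.2, mul_zero]

/-! ### Derivatives and expansions of explicit functions -/

section Derivatives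

variable {F : ℕ → ℝ → ℝ} {s : Set ℝ}

/-- An explicit function is handled through a tower `F` in which each member is the derivative of
the preceding one. -/
theorem iteratedDeriv_eq_of_hasDerivAt (hs : IsOpen s)
    (h : ∀ k, ∀ r ∈ s, HasDerivAt (F k) (F (k + 1) r) r) (k : ℕ) :
    ∀ r ∈ s, iteratedDeriv k (F 0) r = F k r := by
  induction k with
  | zero => intro r _; rw [iteratedDeriv_zero]
  | succ k ih =>
    intro r hr
    have e : iteratedDeriv k (F 0) =ᶠ[𝓝 r] F k := Filter.eventually_of_mem (hs.mem_nhds hr) ih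
    rw [iteratedDeriv_succ, e.deriv_eq, (h k r hr).deriv]

theorem contDiffOn_of_hasDerivAt (hs : IsOpen s)
    (h : ∀ k, ∀ r ∈ s, HasDerivAt (F k) (F (k + 1) r) r) : ContDiffOn ℝ ∞ (F 0) s := by
  have : ∀ (m k : ℕ), ContDiffOn ℝ m (F k) s := by
    intro m
    induction m with
    | zero =>
      exact fun k => contDiffOn_zero.2 fun r hr => (h k r hr).continuousAt.continuousWithinAt
    | succ m ih =>
      intro k
      rw [Nat.cast_succ, contDiffOn_succ_iff_deriv_of_isOpen hs]
      refine ⟨fun r hr => (h k r hr).differentiableAt.differentiableWithinAt, by simp, ?_⟩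
      exact (ih (k + 1)).congr fun r hr => (h k r hr).deriv
  exact contDiffOn_infty.2 fun m => this m 0

end Derivatives

/-- The derivatives of `a₀ + a₁ r + a₂ r² + a₃ r³ + a₄ r⁴`. -/
def quarticJet (a₀ a₁ a₂ a₃ a₄ : ℝ) : ℕ → ℝ → ℝ
  | 0 => fun r => a₀ + a₁ * r + a₂ * r ^ 2 + a₃ * r ^ 3 + a₄ * r ^ 4
  | 1 => fun r => a₁ + 2 * a₂ * r + 3 * a₃ * r ^ 2 + 4 * a₄ * r ^ 3
  | 2 => fun r => 2 * a₂ + 6 * a₃ * r + 12 * a₄ * r ^ 2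
  | 3 => fun r => 6 * a₃ + 24 * a₄ * r
  | 4 => fun _ => 24 * a₄
  | _ => fun _ => 0

theorem hasDerivAt_quarticJet (a₀ a₁ a₂ a₃ a₄ : ℝ) (k : ℕ) (r : ℝ) :
    HasDerivAt (quarticJet a₀ a₁ a₂ a₃ a₄ k) (quarticJet a₀ a₁ a₂ a₃ a₄ (k + 1) r) r := by
  have p (m : ℕ) (c : ℝ) : HasDerivAt (fun r : ℝ => c * r ^ m) (c * (m * r ^ (m - 1))) r :=
    (hasDerivAt_pow m r).const_mul c
  have l (c : ℝ) : HasDerivAt (fun r : ℝ => c * r) c r := by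
    simpa using (hasDerivAt_id r).const_mul c
  match k with
  | 0 =>
    refine (((((l a₁).const_add a₀).add (p 2 a₂)).add (p 3 a₃)).add (p 4 a₄)).congr_deriv ?_
    simp only [quarticJet]; push_cast; ring
  | 1 =>
    refine ((((l (2 * a₂)).const_add a₁).add (p 2 (3 * a₃))).add (p 3 (4 * a₄))).congr_deriv ?_
    simp only [quarticJet]; push_cast; ring
  | 2 =>
    refine (((l (6 * a₃)).const_add (2 * a₂)).add (p 2 (12 * a₄))).congr_deriv ?_
    simp only [quarticJet]; push_cast; ring
  | 3 =>
    exact (l (24 * a₄)).const_add (6 * a₃)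
  | 4 => exact hasDerivAt_const r _
  | k + 5 => exact hasDerivAt_const r _

theorem jet_quartic (a₀ a₁ a₂ a₃ a₄ r : ℝ) :
    jet (quarticJet a₀ a₁ a₂ a₃ a₄ 0) r = fun k => quarticJet a₀ a₁ a₂ a₃ a₄ k r :=
  funext fun k => iteratedDeriv_eq_of_hasDerivAt isOpen_univ
    (fun k r _ => hasDerivAt_quarticJet a₀ a₁ a₂ a₃ a₄ k r) k r (Set.mem_univ r)

theorem contDiff_quartic (a₀ a₁ a₂ a₃ a₄ : ℝ) : ContDiff ℝ ∞ (quarticJet a₀ a₁ a₂ a₃ a₄ 0) :=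
  contDiffOn_univ.1 (contDiffOn_of_hasDerivAt isOpen_univ
    (fun k r _ => hasDerivAt_quarticJet a₀ a₁ a₂ a₃ a₄ k r))

/-- A quartic polynomial that vanishes to order `m` at `r₀` has there an expansion with leading
exponent `m`. -/
theorem hasFrobeniusSeries_quartic (a₀ a₁ a₂ a₃ a₄ r₀ : ℝ) (m : ℕ)
    (h0 : ∀ j < m, iteratedDeriv j (quarticJet a₀ a₁ a₂ a₃ a₄ 0) r₀ = 0)
    (hm : iteratedDeriv m (quarticJet a₀ a₁ a₂ a₃ a₄ 0) r₀ ≠ 0) :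
    HasFrobeniusSeries (quarticJet a₀ a₁ a₂ a₃ a₄ 0) r₀ m
      (fun i => quarticJet a₀ a₁ a₂ a₃ a₄ (m + i) r₀ / (m + i).factorial) := by
  have e : ∀ k, iteratedDeriv k (quarticJet a₀ a₁ a₂ a₃ a₄ 0) r₀ = quarticJet a₀ a₁ a₂ a₃ a₄ k r₀ :=
    fun k => congrFun (jet_quartic a₀ a₁ a₂ a₃ a₄ r₀) k
  refine ⟨div_ne_zero ?_ (by positivity), 1, one_pos, fun r _ => ?_⟩
  · rwa [add_zero, ← e]
  · have hsum : HasSum (fun k => quarticJet a₀ a₁ a₂ a₃ a₄ k r₀ / k.factorial * (r - r₀) ^ k)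
        (quarticJet a₀ a₁ a₂ a₃ a₄ 0 r) := by
      have := hasSum_sum_of_ne_finset_zero (L := .unconditional ℕ) (s := Finset.range 5)
        (f := fun k => quarticJet a₀ a₁ a₂ a₃ a₄ k r₀ / k.factorial * (r - r₀) ^ k) (by
          intro k hk
          rw [Finset.mem_range, not_lt] at hk
          obtain ⟨j, rfl⟩ := Nat.exists_eq_add_of_le' hk
          simp [quarticJet])
      convert this using 1
      simp only [Finset.sum_range_succ, Finset.sum_range_zero, quarticJet, Nat.factorial]
      push_cast
      ring
    -- The first `m` Taylor coefficients vanish, so shifting the index by `m` does not change the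
    -- sum.
    have := (hasSum_nat_add_iff' m).2 hsum
    rw [Finset.sum_eq_zero (fun k hk => by
      rw [← e, h0 k (Finset.mem_range.1 hk), zero_div, zero_mul]), sub_zero] at this
    refine this.congr_fun fun i => ?_
    simp only [← Nat.cast_add, Real.rpow_natCast, add_comm m i]

theorem hasDerivAt_twoTerm (p a₂ ap : ℝ) (k : ℕ) (r : ℝ) (hr : r ∈ Set.Ioi (0 : ℝ)) :
    HasDerivAt (fun r => a₂ * falling 2 k * r ^ (2 - k : ℝ) + ap * falling p k * r ^ (p - k))
      (a₂ * falling 2 (k + 1) * r ^ (2 - (k + 1 : ℕ) : ℝ)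
        + ap * falling p (k + 1) * r ^ (p - (k + 1 : ℕ))) r := by
  have hr' : r ≠ 0 := (Set.mem_Ioi.1 hr).ne'
  refine (((Real.hasDerivAt_rpow_const (p := 2 - k) (Or.inl hr')).const_mul _).add
    ((Real.hasDerivAt_rpow_const (p := p - k) (Or.inl hr')).const_mul _)).congr_deriv ?_
  rw [falling_succ, falling_succ, Nat.cast_succ, ← sub_sub, ← sub_sub]
  ring

theorem twoTerm_eq (p a₂ ap : ℝ) : twoTerm p a₂ ap =
    fun r => a₂ * falling 2 0 * r ^ (2 - (0 : ℕ) : ℝ) + ap * falling p 0 * r ^ (p - (0 : ℕ)) := by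
  funext r
  simp [twoTerm, falling]

theorem contDiffOn_twoTerm (p a₂ ap : ℝ) : ContDiffOn ℝ ∞ (twoTerm p a₂ ap) (Set.Ioi 0) := by
  rw [twoTerm_eq]
  exact contDiffOn_of_hasDerivAt (F := fun k r =>
    a₂ * falling 2 k * r ^ (2 - k : ℝ) + ap * falling p k * r ^ (p - k)) isOpen_Ioi
    (hasDerivAt_twoTerm p a₂ ap)

/-- Up to the scaling weights, the derivatives of `a₂ r² + a_p r^p` are those of
`a₂ r² + (a_p r^(p-2)) r^p` at `r = 1`. -/
theorem isRescaled_jet_twoTerm (p a₂ ap : ℝ) {r : ℝ} (hr : 0 < r) :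
    IsRescaled 1 r r⁻¹ (jet (twoTerm p a₂ ap) r)
      (fun k => a₂ * falling 2 k + ap * r ^ (p - 2) * falling p k) := by
  have e : ∀ k, jet (twoTerm p a₂ ap) r k =
      a₂ * falling 2 k * r ^ (2 - k : ℝ) + ap * falling p k * r ^ (p - k) := fun k => by
    rw [twoTerm_eq]
    exact iteratedDeriv_eq_of_hasDerivAt (F := fun k r =>
      a₂ * falling 2 k * r ^ (2 - k : ℝ) + ap * falling p k * r ^ (p - k)) isOpen_Ioi
      (hasDerivAt_twoTerm p a₂ ap) k r hr
  have e' : ∀ k : ℕ, jet (twoTerm p a₂ ap) r k =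
      r ^ (2 - k : ℝ) * (a₂ * falling 2 k + ap * r ^ (p - 2) * falling p k) := fun k => by
    rw [e, show p - (k : ℝ) = (2 - k) + (p - 2) by ring, Real.rpow_add hr]
    ring
  have neg : ∀ k : ℕ, r ^ (-k : ℝ) = r⁻¹ ^ k := fun k => by
    rw [Real.rpow_neg hr.le, Real.rpow_natCast, inv_pow]
  refine ⟨mul_inv_cancel₀ hr.ne', ?_, ?_, ?_, ?_, ?_, ?_, ?_⟩
  · rw [e', one_mul]; norm_num
  · rw [e', one_mul]; norm_num
  · rw [e', one_mul]; norm_num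
  · rw [e', one_mul, ← pow_one r⁻¹, ← neg]; norm_num
  · rw [e', one_mul, ← neg]; norm_num
  · rw [e', one_mul, ← neg]; norm_num
  · rw [e', one_mul, ← neg]; norm_num

/-! ### Classes of vacuum solutions -/

theorem IsVacuumOn.mono {M : Couplings} {R₀ : ℝ} {f : ℝ → ℝ} {s t : Set ℝ}
    (h : IsVacuumOn M R₀ f s) (hts : t ⊆ s) : IsVacuumOn M R₀ f t :=
  ⟨h.1.mono hts, fun r hr => h.2 r (hts hr)⟩

/-- The indicial theorem already supplies some class for the expansion; only the passage from that
class to the desired one is left to `hK`. -/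
theorem IsVacuumOn.realizesAt {M : Couplings} {R₀ : ℝ} {f : ℝ → ℝ} {r₀ n : ℝ} {a : ℕ → ℝ}
    {K : IndicialClass} (h : IsVacuumOn M R₀ f (Set.Ioi r₀)) (hf : HasFrobeniusSeries f r₀ n a)
    (hK : ∀ K', InClass M R₀ n (a 0) K' → InClass M R₀ n (a 0) K) :
    RealizesAt M R₀ f r₀ K := by
  refine ⟨⟨1, one_pos, h.mono fun r hr => hr.1⟩, n, a, hf, ?_⟩
  obtain ⟨K', hK'⟩ := exists_inClass_of_hasFrobeniusSeries M R₀ hf (by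
    filter_upwards [self_mem_nhdsWithin] with r hr
    exact (h.2 r hr).2)
  exact hK K' hK'

/-- Only `m = 3` leaves a choice to settle, between 1a and 1b. There the relation of 1b reads `6 σ₂
+ 3 σ₃ = 0`, which is that of 1a. -/
theorem inClass_classOfOrder {M : Couplings} {R₀ a₀ : ℝ} {m : ℕ} (hm : m ≤ 3)
    (K : IndicialClass) (h : InClass M R₀ m a₀ K) : InClass M R₀ m a₀ (classOfOrder m) := by
  interval_cases m
  · exact Nat.cast_zero
  · exact Nat.cast_one
  · cases K <;> simp [InClass, classOfOrder] at h ⊢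
    exact h
  · cases K <;> simp [InClass, classOfOrder] at h ⊢
    · exact h
    · obtain ⟨-, k0, -, k1, k2, k3, -⟩ := h
      refine ⟨k0, k1, k2, ?_⟩
      linear_combination k3 / 3
    all_goals norm_num at h

theorem InClass.c2 {M : Couplings} {R₀ a₀ : ℝ} {K : IndicialClass} (h : InClass M R₀ 2 a₀ K) :
    InClass M R₀ 2 a₀ .c2 := by
  cases K
  · have := h.1; norm_num at this
  · have := h.1; norm_num at this
  · exact h
  · have : (2 : ℝ) = 1 := h; norm_num at this
  · have : (2 : ℝ) = 0 := h; norm_num at this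
  · have := h.1; norm_num at this

theorem InClass.c3c {M : Couplings} {R₀ n a₀ : ℝ} {K : IndicialClass} (h : InClass M R₀ n a₀ K)
    (h0 : n ≠ 0) (h1 : n ≠ 1) (h2 : n < 2) : InClass M R₀ n a₀ .c3c := by
  cases K
  · have := h.1; linarith
  · have := h.1; linarith
  · have := h.1; linarith
  · exact absurd h h1
  · exact absurd h h0
  · exact h

/-- For `n = 3` the class at hand may be 1a, which lacks `q₁ = 0` and the cubic condition; the
hypotheses supply them. -/
theorem InClass.c1b {M : Couplings} {R₀ n a₀ : ℝ} {K : IndicialClass} (h : InClass M R₀ n a₀ K)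
    (h2 : 2 < n) (hq : q₁ M R₀ = 0)
    (h3 : q₂ M R₀ * n * (n - 1) * (2 * n - 5)
      - q₃ M R₀ * (n - 2) * (5 * n ^ 2 - 21 * n + 20) = 0) : InClass M R₀ n a₀ .c1b := by
  cases K
  · obtain ⟨hn, k0, k1, k2, k3⟩ := h
    refine ⟨h2, k0, hq, k1, k2, ?_, h3⟩
    rw [hn, k3]
    ring
  · exact h
  · have := h.1; linarith
  · have : n = 1 := h; linarith
  · have : n = 0 := h; linarith
  · have := h.1; linarith

/-- A quartic polynomial with vanishing field equations is a solution whose expansions have the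
expected classes. -/
theorem isVacuumOn_quartic {M : Couplings} {R₀ a₀ a₁ a₂ a₃ a₄ : ℝ}
    (h : ∀ r, Ett M R₀ (fun k => quarticJet a₀ a₁ a₂ a₃ a₄ k r) = 0 ∧
      Err M R₀ (fun k => quarticJet a₀ a₁ a₂ a₃ a₄ k r) = 0 ∧
      Eθθ M R₀ (fun k => quarticJet a₀ a₁ a₂ a₃ a₄ k r) = 0) :
    IsVacuumOn M R₀ (quarticJet a₀ a₁ a₂ a₃ a₄ 0) Set.univ ∧
      RealizesByOrder M R₀ (quarticJet a₀ a₁ a₂ a₃ a₄ 0) := by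
  have hv : IsVacuumOn M R₀ (quarticJet a₀ a₁ a₂ a₃ a₄ 0) Set.univ :=
    ⟨(contDiff_quartic _ _ _ _ _).contDiffOn, fun r _ => by rw [jet_quartic]; exact h r⟩
  refine ⟨hv, fun r₀ m hm h0 hne => ?_⟩
  exact (hv.mono (Set.subset_univ _)).realizesAt
    (hasFrobeniusSeries_quartic a₀ a₁ a₂ a₃ a₄ r₀ m h0 hne) (inClass_classOfOrder hm)

theorem iteratedDeriv_quartic (a₀ a₁ a₂ a₃ a₄ r : ℝ) (k : ℕ) :
    iteratedDeriv k (quarticJet a₀ a₁ a₂ a₃ a₄ 0) r = quarticJet a₀ a₁ a₂ a₃ a₄ k r :=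
  congrFun (jet_quartic a₀ a₁ a₂ a₃ a₄ r) k

/-- `a₂ r² + a_p r^p` near `0`, when the second term is the leading one. -/
theorem hasFrobeniusSeries_twoTerm_of_eq_zero (p : ℝ) {ap : ℝ} (hap : ap ≠ 0) :
    HasFrobeniusSeries (twoTerm p 0 ap) 0 p (fun i => if i = 0 then ap else 0) := by
  refine ⟨by simpa using hap, 1, one_pos, fun r _ => ?_⟩
  have := hasSum_single (f := fun i : ℕ => (if i = 0 then ap else 0) * (r - 0) ^ (p + (i : ℝ))) 0
    (fun i hi => by simp [hi])
  simpa [twoTerm] using this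

theorem hasSum_two_terms (r n b c : ℝ) {k : ℕ} (hk : k ≠ 0) :
    HasSum (fun i : ℕ => (if i = 0 then b else if i = k then c else 0) * (r - 0) ^ (n + (i : ℝ)))
      (b * r ^ n + c * r ^ (n + k)) := by
  have := hasSum_sum_of_ne_finset_zero (L := .unconditional ℕ) (s := {0, k})
    (f := fun i : ℕ => (if i = 0 then b else if i = k then c else 0) * (r - 0) ^ (n + (i : ℝ))) (by
      intro i hi
      simp only [Finset.mem_insert, Finset.mem_singleton, not_or] at hi
      simp [hi.1, hi.2])
  rw [Finset.sum_pair hk.symm] at this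
  simpa [hk] using this

theorem hasFrobeniusSeries_twoTerm_two {a₂ : ℝ} (ha : a₂ ≠ 0) (ap : ℝ) {k : ℕ} (hk : k ≠ 0) :
    HasFrobeniusSeries (twoTerm (2 + k) a₂ ap) 0 2
      (fun i => if i = 0 then a₂ else if i = k then ap else 0) := by
  refine ⟨by simpa using ha, 1, one_pos, fun r _ => ?_⟩
  have := hasSum_two_terms r 2 a₂ ap hk
  rwa [Real.rpow_two] at this

theorem hasFrobeniusSeries_twoTerm_sub (a₂ : ℝ) {ap : ℝ} (hap : ap ≠ 0) {k : ℕ} (hk : k ≠ 0) :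
    HasFrobeniusSeries (twoTerm (2 - k) a₂ ap) 0 (2 - k)
      (fun i => if i = 0 then ap else if i = k then a₂ else 0) := by
  refine ⟨by simpa using hap, 1, one_pos, fun r _ => ?_⟩
  have := hasSum_two_terms r (2 - k) ap a₂ hk
  rwa [sub_add_cancel, Real.rpow_two, add_comm] at this

/-! ### Polynomial solutions -/

/-- Since `f'' = 0`, only the constants `q₀` and `σ₀` survive, and they vanish by the equations for
`R₀ ^ 2` and `Λ`. -/
theorem IsLinearForm.isVacuumOn {M : Couplings} {R₀ : ℝ} {f : ℝ → ℝ} (hR : 0 < R₀)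
    (h : IsLinearForm M R₀ f) :
    IsVacuumOn M R₀ f Set.univ ∧ RealizesByOrder M R₀ f := by
  obtain ⟨hγ, hD, hX, hΛ, a₀, a₁, -, rfl⟩ := h
  -- Both signs of the root say that `R₀ ^ 2` solves `3 γ X² - 4 (α - 3 β) X + w = 0`.
  have hw : w M = 4 * (M.α - 3 * M.β) * R₀ ^ 2 - 3 * M.γ * R₀ ^ 4 := by
    have hs := Real.sq_sqrt hD
    set s := √(4 * (M.α - 3 * M.β) ^ 2 - 3 * M.γ * w M)
    have hs' : (3 * M.γ * R₀ ^ 2 - 2 * (M.α - 3 * M.β)) ^ 2 = s ^ 2 := by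
      rcases hX with hX | hX <;> rw [hX] <;> field_simp <;> ring
    have : M.γ * w M = M.γ * (4 * (M.α - 3 * M.β) * R₀ ^ 2 - 3 * M.γ * R₀ ^ 4) := by
      linear_combination (hs' + hs) / 3
    exact mul_left_cancel₀ hγ this
  have hL : M.Λ * (9 * M.γ * R₀ ^ 4) = -(2 * (M.α - 3 * M.β - 3 * M.γ * R₀ ^ 2)) := by
    rw [hΛ]; field_simp
  have e : (fun r => a₀ + a₁ * r) = quarticJet a₀ a₁ 0 0 0 0 := by
    funext r; simp [quarticJet]
  rw [e]
  simp only [w] at hw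
  refine isVacuumOn_quartic fun r => ⟨?_, ?_, ?_⟩ <;>
    simp only [Ett, Err, Eθθ, quarticJet, smul_eq_mul, Algebra.algebraMap_self_apply]
  · linear_combination 4 * hw - 4 * R₀ ^ 2 * hL
  · linear_combination 4 * hw - 4 * R₀ ^ 2 * hL
  · linear_combination -16 * hw - 8 * R₀ ^ 2 * hL

/-- Here `f'' = 2 a₂` is constant and higher derivatives vanish; the equations are linear
combinations of the two hypotheses. -/
theorem IsQuadraticForm.isVacuumOn {M : Couplings} {R₀ : ℝ} {f : ℝ → ℝ}
    (h : IsQuadraticForm M R₀ f) :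
    IsVacuumOn M R₀ f Set.univ ∧ RealizesByOrder M R₀ f := by
  obtain ⟨a₀, a₁, a₂, -, rfl, h1, h2⟩ := h
  have e : (fun r => a₀ + a₁ * r + a₂ * r ^ 2) = quarticJet a₀ a₁ a₂ 0 0 0 := by
    funext r; simp [quarticJet]
  rw [e]
  simp only [c₁, c₂] at h1 h2
  refine isVacuumOn_quartic fun r => ⟨?_, ?_, ?_⟩ <;>
    simp only [Ett, Err, Eθθ, quarticJet, smul_eq_mul, Algebra.algebraMap_self_apply]
  · linear_combination 2 * h1 + 2 * h2
  · linear_combination 2 * h1 + 2 * h2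
  · linear_combination -4 * h1 + 4 * h2

theorem IsCubicForm.isVacuumOn {M : Couplings} {R₀ : ℝ} {f : ℝ → ℝ} (hR : 0 < R₀)
    (h : IsCubicForm M R₀ f) :
    IsVacuumOn M R₀ f Set.univ ∧ RealizesByOrder M R₀ f := by
  obtain ⟨hγ, hβ, h12, h1, h3, hw, hX, hΛ, a₀, a₁, a₂, a₃, ha₃, ha₁, rfl⟩ := h
  -- The root is `0` on nonpositive arguments, so `R₀ > 0` forces `c₂ / γ > 0`.
  have hpos : 0 < √(c₂ M / M.γ) := by
    have : 0 < R₀ ^ 2 := by positivity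
    linarith
  have hc : c₂ M = 9 / 4 * M.γ * R₀ ^ 4 := by
    have h4 := Real.sq_sqrt (Real.sqrt_pos.1 hpos).le
    have : c₂ M / M.γ = 9 / 4 * R₀ ^ 4 := by
      linear_combination -h4 - 9 / 4 * (R₀ ^ 2 + 2 / 3 * √(c₂ M / M.γ)) * hX
    rw [div_eq_iff hγ] at this
    linear_combination this
  -- This product unites the two alternatives; it and the relation for `a₁` are all that the
  -- equations need once the other couplings are eliminated.
  have hΛα : M.Λ * (M.α - 3 / 4 * M.γ * R₀ ^ 2) = 0 := by
    rcases hΛ with hΛ | ⟨hγ', hα⟩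
    · rw [hΛ, zero_mul]
    · have : √(M.γ * c₂ M) = 3 / 2 * M.γ * R₀ ^ 2 := by
        rw [hc, show M.γ * (9 / 4 * M.γ * R₀ ^ 4) = (3 / 2 * M.γ * R₀ ^ 2) ^ 2 by ring]
        exact Real.sqrt_sq (by positivity)
      rw [hα, this]
      ring
  have ha : 3 * a₁ * a₃ * R₀ ^ 4 = a₂ ^ 2 * R₀ ^ 4 + 2 * M.Λ * R₀ ^ 2 - 1 := by
    rw [ha₁]; field_simp
  have e : (fun r => a₀ + a₁ * r + a₂ * r ^ 2 + a₃ * r ^ 3) = quarticJet a₀ a₁ a₂ a₃ 0 0 := by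
    funext r; simp [quarticJet]
  have h2 : M.η₂ = M.η₁ / 3 := by linear_combination -h12 / 3
  have h6 : M.η₆ = -3 * M.η₄ - 3 / 4 * M.γ * R₀ ^ 4 := by
    simp only [c₂] at hc
    linear_combination -hc / 3
  have h8 : M.η₈ = -(36 * M.η₃ + 9 * M.η₄ + 3 * M.η₆ + 12 * M.η₇) / 2 := by
    simp only [w] at hw
    linear_combination hw / 2 - h12
  rw [e]
  refine isVacuumOn_quartic fun r => ⟨?_, ?_, ?_⟩ <;>
    simp only [Ett, Err, Eθθ, quarticJet, smul_eq_mul, Algebra.algebraMap_self_apply] <;>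
    rw [h8, h3, h2, h1, hβ, h6]
  · linear_combination (-12 * R₀ ^ 2 * (2 * M.α - 3 * M.γ * R₀ ^ 2)) * ha
      - 48 * R₀ ^ 4 * hΛα
  · linear_combination (-12 * R₀ ^ 2 * (2 * M.α - 3 * M.γ * R₀ ^ 2)) * ha
      - 48 * R₀ ^ 4 * hΛα
  · linear_combination (48 * R₀ ^ 2 * M.α) * ha + 96 * R₀ ^ 4 * hΛα

theorem IsCubicQuarticForm.isVacuumOn {M : Couplings} {R₀ : ℝ} {f : ℝ → ℝ} (hR : 0 < R₀)
    (h : IsCubicQuarticForm M R₀ f) :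
    IsVacuumOn M R₀ f Set.univ ∧ RealizesAt M R₀ f 0 .c1a ∧
        q₁ M R₀ = -18 * M.γ / M.Λ ^ 4 ∧ q₁ M R₀ ≠ 0 := by
  obtain ⟨hX, hγ, hα, h12, h1, h4, h6, h7, h8, a₃, ha₃, rfl⟩ := h
  have hR2 : 0 < R₀ ^ 2 := by positivity
  -- Division by zero gives `0`, so `Λ = 0` would make `R₀` vanish.
  have hΛ : M.Λ ≠ 0 := by
    rintro h0
    rw [h0, div_zero] at hX
    exact hR2.ne' hX
  have hL : M.Λ = 1 / R₀ ^ 2 := by rw [hX, one_div_one_div]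
  have h2 : M.η₂ = -M.η₁ / 15 := by linear_combination h12 / 15
  rw [hL] at hα h1 h4 h6 h7 h8
  have hα' : M.α = 3 * M.β - 3 / 2 * M.γ * R₀ ^ 2 := by rw [hα]; field_simp
  have h1' : M.η₁ = 45 / 32 * M.γ * R₀ ^ 4 := by rw [h1]; field_simp
  have h4' : M.η₄ = M.β * R₀ ^ 2 - 13 / 48 * M.γ * R₀ ^ 4 := by rw [h4]; field_simp
  have h6' : M.η₆ = -3 * M.β * R₀ ^ 2 - 35 / 16 * M.γ * R₀ ^ 4 := by rw [h6]; field_simp; ring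
  have h7' : M.η₇ = 39 / 64 * M.γ * R₀ ^ 4 - 3 / 4 * M.β * R₀ ^ 2 - 9 * M.η₃ := by
    rw [h7]; field_simp; ring
  have h8' : M.η₈ = 9 / 2 * M.β * R₀ ^ 2 + 36 * M.η₃ - 117 / 32 * M.γ * R₀ ^ 4 := by
    rw [h8]; field_simp; ring
  have e : (fun r => a₃ * r ^ 3 - 45 * a₃ ^ 2 * r ^ 4 / (64 * M.Λ))
      = quarticJet 0 0 0 a₃ (-45 / 64 * a₃ ^ 2 * R₀ ^ 2) 0 := by
    funext r
    rw [hL]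
    simp only [quarticJet]
    field_simp
    ring
  rw [e]
  have hv := isVacuumOn_quartic (M := M) (R₀ := R₀) (a₀ := 0) (a₁ := 0) (a₂ := 0) (a₃ := a₃)
    (a₄ := -45 / 64 * a₃ ^ 2 * R₀ ^ 2) fun r => by
      refine ⟨?_, ?_, ?_⟩ <;>
      simp only [Ett, Err, Eθθ, quarticJet, smul_eq_mul, Algebra.algebraMap_self_apply] <;>
      rw [h8', h7', h6', h4', h2, h1', hα', hL] <;> field_simp <;> ring
  have hq : q₁ M R₀ = -18 * M.γ / M.Λ ^ 4 := by
    rw [q₁, h8', h7', h6', h4', hα', hL]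
    field_simp
    ring
  refine ⟨hv.1, hv.2 0 3 le_rfl ?_ ?_, hq, ?_⟩
  · intro j hj
    rw [iteratedDeriv_quartic]
    interval_cases j <;> simp [quarticJet]
  · rw [iteratedDeriv_quartic]
    simpa [quarticJet] using ha₃
  · rw [hq]
    exact div_ne_zero (mul_ne_zero (by norm_num) hγ) (pow_ne_zero _ hΛ)

theorem IsQuadraticQuarticForm.isVacuumOn {M : Couplings} {R₀ : ℝ} {f : ℝ → ℝ} (hR : 0 < R₀)
    (h : IsQuadraticQuarticForm M R₀ f) :
    IsVacuumOn M R₀ f Set.univ ∧ RealizesAt M R₀ f 0 .c2 := by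
  obtain ⟨hγ, hδ, h12, h1, h4, h6, h7, h8, hΛ, hX, a₄, -, rfl⟩ := h
  have hα : M.α = 3 * M.β - 3 / 2 * M.γ * R₀ ^ 2 := by rw [hX]; field_simp; ring
  have hR2 : R₀ ^ 2 ≠ 0 := by positivity
  -- The radius condition trades `α - 3 β` for `γ R₀ ^ 2`, so that the only denominators left
  -- besides numbers are powers of `R₀`.
  have hδ' : M.α - 3 * M.β = -(3 / 2 * M.γ * R₀ ^ 2) := by rw [hα]; ring
  have h2 : M.η₂ = -M.η₁ / 69 := by linear_combination h12 / 69
  rw [hδ'] at h1 h4 h6 h7 h8 hΛ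
  have h1' : M.η₁ = 391 / 984 * M.γ * R₀ ^ 4 := by rw [h1]; field_simp; ring
  have h4' : M.η₄ = -(104 * M.α - 5847 * M.β) * R₀ ^ 2 / 5535 := by rw [h4]; field_simp; ring
  have h6' : M.η₆ = -(1201 * M.α + 1932 * M.β) * R₀ ^ 2 / 1845 := by rw [h6]; field_simp; ring
  have h7' : M.η₇ = (1987 * M.α - 22566 * M.β) * R₀ ^ 2 / 22140 - 9 * M.η₃ := by
    rw [h7]; field_simp; ring
  have h8' : M.η₈ = (4648 * M.α + 2661 * M.β) * R₀ ^ 2 / 3690 + 36 * M.η₃ := by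
    rw [h8]; field_simp; ring
  have hL : M.Λ = 2961 / 656 / R₀ ^ 2 := by rw [hΛ]; field_simp; ring
  have hq : (fun r => 15 * M.γ * r ^ 2 / (8 * (M.α - 3 * M.β)) + a₄ * r ^ 4)
      = quarticJet 0 0 (-5 / 4 / R₀ ^ 2) 0 a₄ 0 := by
    funext r
    rw [hδ']
    simp only [quarticJet]
    field_simp
    ring
  rw [hq]
  have hv := isVacuumOn_quartic (M := M) (R₀ := R₀) (a₀ := 0) (a₁ := 0) (a₂ := -5 / 4 / R₀ ^ 2)
    (a₃ := 0) (a₄ := a₄) fun r => by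
      refine ⟨?_, ?_, ?_⟩ <;>
      simp only [Ett, Err, Eθθ, quarticJet, smul_eq_mul, Algebra.algebraMap_self_apply] <;>
      rw [h8', h7', h6', h4', h2, h1', hα, hL] <;> field_simp <;> ring
  refine ⟨hv.1, hv.2 0 2 (by norm_num) ?_ ?_⟩
  · intro j hj
    rw [iteratedDeriv_quartic]
    interval_cases j <;> simp [quarticJet]
  · rw [iteratedDeriv_quartic]
    simpa [quarticJet] using hR.ne'

/-! ### Solutions with real powers -/

/-- The field equations for `a₂ r² + a_p r^p`, as conditions on the couplings. -/
theorem isVacuumOn_twoTerm {M : Couplings} {R₀ p a₂ ap : ℝ}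
    (h : ∀ r > 0, ∀ g : ℕ → ℝ, (∀ k, g k = a₂ * falling 2 k + ap * r ^ (p - 2) * falling p k) →
      Ett M R₀ g = 0 ∧ Err M R₀ g = 0 ∧ Eθθ M R₀ g = 0) :
    IsVacuumOn M R₀ (twoTerm p a₂ ap) (Set.Ioi 0) := by
  refine ⟨contDiffOn_twoTerm p a₂ ap, fun r hr => ?_⟩
  have e := isRescaled_jet_twoTerm p a₂ ap hr
  -- The trivial rescaling brings the hypothesis to the same normal form as the equations for the
  -- jet.
  have id : ∀ g : ℕ → ℝ, IsRescaled 1 1 1 g g := fun g => by constructor <;> simp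
  obtain ⟨h1, h2, h3⟩ := h r hr _ fun k => rfl
  rw [Ett_of_isRescaled M R₀ (id _)] at h1
  rw [Err_of_isRescaled M R₀ (id _)] at h2
  rw [Eθθ_of_isRescaled M R₀ (id _)] at h3
  exact ⟨by rw [Ett_of_isRescaled M R₀ e, h1], by rw [Err_of_isRescaled M R₀ e, h2],
    by rw [Eθθ_of_isRescaled M R₀ e, h3]⟩

theorem falling_values (n : ℝ) :
    falling n 0 = 1 ∧ falling n 1 = n ∧ falling n 2 = n * (n - 1) ∧
      falling n 3 = n * (n - 1) * (n - 2) ∧ falling n 4 = n * (n - 1) * (n - 2) * (n - 3) ∧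
      falling n 5 = n * (n - 1) * (n - 2) * (n - 3) * (n - 4) ∧
      falling n 6 = n * (n - 1) * (n - 2) * (n - 3) * (n - 4) * (n - 5) := by
  simp [falling, Finset.prod_range_succ]

/-- The couplings make all `q`s vanish, so `Ett` and `Err` are identically zero. In `Eθθ` only `σ₃`,
`σ₅`, `σ₆`, `σ₇` remain, and `hS`, `hC` express `σ₃` and `σ₆` through `η₂`. -/
theorem IsTwoTermModel.isVacuumOn {M : Couplings} {R₀ p a₂ : ℝ} (hR : 0 < R₀)
    (h : IsTwoTermModel M R₀ p a₂) (ap : ℝ) :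
    IsVacuumOn M R₀ (twoTerm p a₂ ap) (Set.Ioi 0) := by
  obtain ⟨hp0, hp1, hγ, hα, h1, h6, h7, h8, hX⟩ := h
  have hp1' : p - 1 ≠ 0 := sub_ne_zero.2 hp1
  have hR2 : R₀ ^ 2 ≠ 0 := by positivity
  have hden : (p - 1) * p * M.β + (p - 3) * (p - 2) * (p ^ 2 + p - 4) * a₂ * M.η₂ ≠ 0 := by
    intro h0
    rw [h0, div_zero, neg_zero] at hX
    exact hR2 hX
  rw [← neg_div, eq_div_iff hden] at hX
  have h7' : (p - 1) * p * (M.η₇ + 9 * M.η₃ + 3 / 4 * M.η₄)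
      = 6 * (p - 2) * (2 * p - 3) * M.η₂ := by
    rw [h7]; field_simp; ring
  refine isVacuumOn_twoTerm fun r _ g hg => ?_
  -- All dependence on `r` sits in this one quantity, and the equations hold for every value of it.
  generalize ap * r ^ (p - 2) = b at hg
  obtain ⟨u0, u1, u2, u3, u4, u5, u6⟩ := falling_values 2
  obtain ⟨v0, v1, v2, v3, v4, v5, v6⟩ := falling_values p
  have g0 := hg 0; have g1 := hg 1; have g2 := hg 2; have g3 := hg 3
  have g4 := hg 4; have g5 := hg 5; have g6 := hg 6
  rw [u0, v0] at g0; rw [u1, v1] at g1; rw [u2, v2] at g2; rw [u3, v3] at g3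
  rw [u4, v4] at g4; rw [u5, v5] at g5; rw [u6, v6] at g6
  refine ⟨?_, ?_, ?_⟩ <;>
    simp only [Ett, Err, Eθθ, smul_eq_mul, Algebra.algebraMap_self_apply] <;>
    rw [h8, h6, h1, hα, hγ]
  · ring
  · ring
  · have hS : (p - 1) * p * (2 * R₀ ^ 2 * (3 * M.β + 6 * M.β) - 4 * (3 * M.η₂) + 12 * M.η₂
        + 72 * M.η₃ - 6 * M.η₄ + -3 * M.η₄ - 2 * (-6 * (3 * M.η₃ + M.η₇)))
        = -18 * R₀ ^ 2 * ((p - 3) * (p - 2) * (p ^ 2 + p - 4) * a₂ * M.η₂) := by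
      linear_combination 18 * hX + 12 * h7'
    have hC : (p - 1) * p * (72 * M.η₃ + 6 * M.η₄ - -3 * M.η₄ - 2 * (-6 * (3 * M.η₃ + M.η₇)))
        = 72 * (p - 2) * (2 * p - 3) * M.η₂ := by
      linear_combination 12 * h7'
    -- Multiplication by `(p - 1) * p` clears the denominator in `η₇`.
    refine (mul_eq_zero.1 (show ((p - 1) * p) * _ = 0 from ?_)).resolve_left (mul_ne_zero hp1' hp0)
    generalize g 0 = x₀, g 1 = x₁, g 2 = x₂, g 3 = x₃, g 4 = x₄, g 5 = x₅, g 6 = x₆ at *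
    subst g0 g1 g2 g3 g4 g5 g6
    linear_combination (12 * R₀ ^ 4 * ((a₂ * 2 + b * p) * (a₂ * (2 * (2 - 1) * (2 - 2))
        + b * (p * (p - 1) * (p - 2))) + (a₂ * 1 + b * 1) *
          (a₂ * (2 * (2 - 1) * (2 - 2) * (2 - 3)) + b * (p * (p - 1) * (p - 2) * (p - 3))))) * hS
      - 6 * R₀ ^ 6 * ((a₂ * 1 + b * 1) * (a₂ * (2 * (2 - 1) * (2 - 2))
        + b * (p * (p - 1) * (p - 2))) ^ 2 + ((a₂ * 2 + b * p) * (a₂ * (2 * (2 - 1) * (2 - 2))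
        + b * (p * (p - 1) * (p - 2))) + (a₂ * 1 + b * 1) *
          (a₂ * (2 * (2 - 1) * (2 - 2) * (2 - 3)) + b * (p * (p - 1) * (p - 2) * (p - 3))))
          * (a₂ * (2 * (2 - 1)) + b * (p * (p - 1)))) * hC

theorem IsTwoTermModel.q_eq_zero {M : Couplings} {R₀ p a₂ : ℝ} (h : IsTwoTermModel M R₀ p a₂) :
    q₁ M R₀ = 0 ∧ q₂ M R₀ = 0 ∧ q₃ M R₀ = 0 := by
  obtain ⟨-, -, -, hα, h1, h6, -, h8, -⟩ := h
  refine ⟨?_, ?_, ?_⟩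
  · rw [q₁, h8, h6, hα]; ring
  · rw [q₂, h8, h6]; ring
  · rw [q₃, h1]; ring

theorem IsTwoTermModel.realizesAt_c1b {M : Couplings} {R₀ p ap : ℝ} (hR : 0 < R₀) (hap : ap ≠ 0)
    (h : IsTwoTermModel M R₀ p 0) (hp : 2 < p) : RealizesAt M R₀ (twoTerm p 0 ap) 0 .c1b := by
  obtain ⟨h1, h2, h3⟩ := h.q_eq_zero
  refine (h.isVacuumOn hR ap).realizesAt (hasFrobeniusSeries_twoTerm_of_eq_zero p hap)
    fun K hK => hK.c1b hp h1 ?_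
  rw [h2, h3]
  ring

theorem IsTwoTermModel.realizesAt_c2 {M : Couplings} {R₀ a₂ ap : ℝ} {k : ℕ} (hR : 0 < R₀)
    (h : IsTwoTermModel M R₀ (2 + k) a₂) (ha : a₂ ≠ 0) (hk : k ≠ 0) :
    RealizesAt M R₀ (twoTerm (2 + k) a₂ ap) 0 .c2 :=
  (h.isVacuumOn hR ap).realizesAt (hasFrobeniusSeries_twoTerm_two ha ap hk) fun _ hK => hK.c2

theorem IsTwoTermModel.realizesAt_c3c {M : Couplings} {R₀ p a₂ ap : ℝ} (hR : 0 < R₀)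
    (hap : ap ≠ 0) (h : IsTwoTermModel M R₀ p a₂) (hp : p < 2) (ha : a₂ = 0 ∨ ∃ k : ℕ, p = 2 - k) :
    RealizesAt M R₀ (twoTerm p a₂ ap) 0 .c3c := by
  have h0 := h.1
  have h1 := h.2.1
  rcases ha with rfl | ⟨k, rfl⟩
  · exact (h.isVacuumOn hR ap).realizesAt (hasFrobeniusSeries_twoTerm_of_eq_zero p hap)
      fun K hK => hK.c3c h0 h1 hp
  · have hk : k ≠ 0 := by
      rintro rfl
      simp at hp
    exact (h.isVacuumOn hR ap).realizesAt (hasFrobeniusSeries_twoTerm_sub a₂ hap hk)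
      fun K hK => hK.c3c h0 h1 hp

/-- The couplings of the power-law model as polynomials in free parameters. -/
theorem IsPowerModel.exists_parameters {M : Couplings} {R₀ p : ℝ} (hR : 0 < R₀)
    (h : IsPowerModel M R₀ p) : ∃ c e k : ℝ,
      M.Λ = 1 / (3 * R₀ ^ 2) ∧
      M.γ = c * ((p - 2) * (2 * p - 3) * (p * (5 * p - 21) + 20)) ∧
      M.η₁ = 3 * R₀ ^ 2 * e * (p * (p - 1)) ∧ M.η₄ = 3 * R₀ ^ 2 * k ∧ M.η₆ = -9 * R₀ ^ 2 * k ∧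
      M.α = 9 * k - R₀ ^ 2 * c * ((p - 1) * (3 * p - 4) * p ^ 2) / 12
        - 12 * e * ((p - 2) * (2 * p - 3)) ∧
      M.β = -c * ((p - 2) * (2 * p - 3) * (p * (5 * p - 21) + 20)) * R₀ ^ 2 / 2 + 3 * k
        - R₀ ^ 2 * c * ((p - 1) * (3 * p - 4) * p ^ 2) / 36 - 4 * e * ((p - 2) * (2 * p - 3)) ∧
      M.η₂ = R₀ ^ 2 * e * (p * (p - 1))
        + c * R₀ ^ 4 * ((2 * p - 3) * (p - 1) * p * (2 * p - 5)) / 6 ∧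
      M.η₇ = -9 * M.η₃ - 9 * R₀ ^ 2 * k / 4
        + c * R₀ ^ 4 * ((2 * p - 3) * (7 * p - 15) * (13 * (p - 4) * p + 48)) / 24
        + 6 * R₀ ^ 2 * e * ((p - 2) * (2 * p - 3)) ∧
      M.η₈ = 36 * M.η₃ + 27 * R₀ ^ 2 * k / 2
        + c * R₀ ^ 4 * ((2 * p - 3) * (p * ((373 - 61 * p) * p - 744) + 480)) / 4
        - 36 * R₀ ^ 2 * e * ((p - 2) * (2 * p - 3)) := by
  obtain ⟨hp0, hp1, hp32, hp2, hpp, hpm, hX, hα, hβ, h2, h6, h7, h8⟩ := h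
  have d1 : p - 1 ≠ 0 := sub_ne_zero.2 hp1
  have d2 : p - 2 ≠ 0 := sub_ne_zero.2 hp2
  have d3 : 2 * p - 3 ≠ 0 := fun h => hp32 (by linear_combination h / 2)
  have dQ : p * (5 * p - 21) + 20 ≠ 0 := by
    have hs : √41 ^ 2 = (41 : ℝ) := Real.sq_sqrt (by norm_num)
    intro h0
    have : (p - (21 + √41) / 10) * (p - (21 - √41) / 10) = 0 := by
      linear_combination h0 / 5 - hs / 100
    rcases mul_eq_zero.1 this with h | h
    · exact hpp (sub_eq_zero.1 h)
    · exact hpm (sub_eq_zero.1 h)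
  have hR2 : R₀ ^ 2 ≠ 0 := by positivity
  have hL : M.Λ = 1 / (3 * R₀ ^ 2) := by
    rw [hX]
    -- For `Λ = 0` both sides are `0` by the convention for division.
    by_cases h0 : M.Λ = 0
    · simp [h0]
    · field_simp
  clear hp32 hpp hpm
  -- As atoms, the two nonzero factors can be cancelled without being expanded.
  generalize p * (5 * p - 21) + 20 = Q at *
  generalize 2 * p - 3 = s at *
  refine ⟨M.γ / ((p - 2) * s * Q), M.η₁ / (3 * R₀ ^ 2 * (p * (p - 1))),
    M.η₄ / (3 * R₀ ^ 2), hL, ?_, ?_, ?_, ?_, ?_, ?_, ?_, ?_, ?_⟩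
  · field_simp
  · field_simp
  · field_simp
  · rw [h6]; field_simp; ring
  · rw [hα, hL]; field_simp; ring
  · rw [hβ, hL]; field_simp; ring
  · rw [h2, hL]; field_simp; ring
  · rw [h7, hL]; field_simp; ring
  · rw [h8, hL]; field_simp; ring

theorem twoTerm_zero (p ap : ℝ) : twoTerm p 0 ap = fun r => ap * r ^ p := by
  funext r
  simp [twoTerm]

/-- In the parameters `c`, `e`, `k` no denominator in `p` is left, and `Λ` enters only through `R₀ ^
2 * Λ = 1 / 3`; the equations become polynomial identities. -/
theorem IsPowerModel.isVacuumOn {M : Couplings} {R₀ p : ℝ} (hR : 0 < R₀)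
    (h : IsPowerModel M R₀ p) (ap : ℝ) :
    IsVacuumOn M R₀ (twoTerm p 0 ap) (Set.Ioi 0) := by
  obtain ⟨c, e, k, hL, hγ, h1, h4, h6, hα, hβ, h2, h7, h8⟩ := h.exists_parameters hR
  have hLX : R₀ ^ 2 * M.Λ = 1 / 3 := by
    rw [hL]; field_simp
  refine isVacuumOn_twoTerm fun r _ g hg => ?_
  generalize ap * r ^ (p - 2) = b at hg
  obtain ⟨v0, v1, v2, v3, v4, v5, v6⟩ := falling_values p
  simp only [zero_mul, zero_add] at hg
  have e0 : ∀ X : ℝ, X * R₀ ^ 4 * M.γ * (1 - M.Λ * R₀ ^ 2) = X * R₀ ^ 4 * M.γ * (2 / 3) := by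
    intro X
    linear_combination (-X * R₀ ^ 4 * M.γ) * hLX
  have e1 : ∀ X : ℝ, X * R₀ ^ 6 * M.γ * M.Λ = X * R₀ ^ 4 * M.γ / 3 := by
    intro X
    linear_combination (X * R₀ ^ 4 * M.γ) * hLX
  refine ⟨?_, ?_, ?_⟩ <;>
    simp only [Ett, Err, Eθθ, smul_eq_mul, Algebra.algebraMap_self_apply, hg, v0, v1, v2, v3, v4,
      v5, v6, e0, e1] <;>
    rw [h8, h7, h6, h4, h2, h1, hα, hβ, hγ] <;> ring

theorem IsPowerModel.q₁_eq_zero_and_indicial {M : Couplings} {R₀ p : ℝ} (hR : 0 < R₀)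
    (h : IsPowerModel M R₀ p) : q₁ M R₀ = 0 ∧ q₂ M R₀ * p * (p - 1) * (2 * p - 5)
      - q₃ M R₀ * (p - 2) * (5 * p ^ 2 - 21 * p + 20) = 0 := by
  obtain ⟨c, e, k, hL, hγ, h1, h4, h6, hα, hβ, h2, h7, h8⟩ := h.exists_parameters hR
  constructor
  · rw [q₁, h8, h7, h6, h4, hα, hβ]; ring
  · rw [q₂, q₃, h8, h7, h6, h4, h2, h1]; ring

theorem IsPowerModel.realizesAt_c1b {M : Couplings} {R₀ p ap : ℝ} (hR : 0 < R₀) (hap : ap ≠ 0)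
    (h : IsPowerModel M R₀ p) (hp : 2 < p) :
    RealizesAt M R₀ (fun r => ap * r ^ p) 0 .c1b := by
  obtain ⟨h1, h2⟩ := h.q₁_eq_zero_and_indicial hR
  rw [← twoTerm_zero]
  exact (h.isVacuumOn hR ap).realizesAt (hasFrobeniusSeries_twoTerm_of_eq_zero p hap)
    fun K hK => hK.c1b hp h1 h2

theorem IsPowerModel.realizesAt_c3c {M : Couplings} {R₀ p ap : ℝ} (hR : 0 < R₀) (hap : ap ≠ 0)
    (h : IsPowerModel M R₀ p) (hp : p < 2) :
    RealizesAt M R₀ (fun r => ap * r ^ p) 0 .c3c := by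
  rw [← twoTerm_zero]
  exact (h.isVacuumOn hR ap).realizesAt (hasFrobeniusSeries_twoTerm_of_eq_zero p hap)
    fun K hK => hK.c3c h.1 h.2.1 hp

/-! ### Realization of the classes -/

/-- A model is not degenerate if some quartic polynomial violates its field equations at `0`. -/
theorem exists_not_isVacuumOn (M : Couplings) (R₀ a₀ a₁ a₂ a₃ a₄ : ℝ)
    (h : Err M R₀ (fun k => quarticJet a₀ a₁ a₂ a₃ a₄ k 0) ≠ 0 ∨
      Eθθ M R₀ (fun k => quarticJet a₀ a₁ a₂ a₃ a₄ k 0) ≠ 0) :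
    ∃ g : ℝ → ℝ, ContDiff ℝ ∞ g ∧ ¬ IsVacuumOn M R₀ g Set.univ := by
  refine ⟨_, contDiff_quartic a₀ a₁ a₂ a₃ a₄, fun hv => ?_⟩
  have := (hv.2 0 (Set.mem_univ 0)).2
  rw [jet_quartic] at this
  exact h.elim (fun h => h this.1) (fun h => h this.2)

theorem realized_of_realizesByOrder {Form : Couplings → ℝ → (ℝ → ℝ) → Prop} {M : Couplings}
    {R₀ : ℝ} {f : ℝ → ℝ} (hR : 0 < R₀) (hF : Form M R₀ f)
    (hM : ∃ g : ℝ → ℝ, ContDiff ℝ ∞ g ∧ ¬ IsVacuumOn M R₀ g Set.univ)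
    (hf : RealizesByOrder M R₀ f) (m : ℕ) (hm : m ≤ 3) (a₀ a₁ a₂ a₃ : ℝ)
    (e : f = quarticJet a₀ a₁ a₂ a₃ 0 0) (h0 : ∀ j < m, quarticJet a₀ a₁ a₂ a₃ 0 j 0 = 0)
    (hne : quarticJet a₀ a₁ a₂ a₃ 0 m 0 ≠ 0) : Realized Form (classOfOrder m) := by
  refine ⟨M, R₀, f, 0, hR, hF, hM, hf 0 m hm ?_ ?_⟩
  · intro j hj
    rw [e, iteratedDeriv_quartic, h0 j hj]
  · rwa [e, iteratedDeriv_quartic]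

/-- Here `α = 3 β` and `w = -3`: the discriminant is `9` and the positive root gives `R₀ = 1`. -/
noncomputable def linearModel : Couplings where
  γ := 1
  Λ := 2 / 3
  α := 0
  β := 0
  η₁ := 0
  η₂ := 0
  η₃ := 0
  η₄ := 0
  η₅ := 0
  η₆ := 0
  η₇ := 0
  η₈ := -3 / 2

theorem isLinearForm_linearModel (a₀ : ℝ) : IsLinearForm linearModel 1 (fun r => a₀ + 1 * r) := by
  refine ⟨by simp [linearModel], by norm_num [linearModel, w], Or.inl ?_,
    by norm_num [linearModel], a₀, 1, one_ne_zero, rfl⟩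
  have : 4 * (linearModel.α - 3 * linearModel.β) ^ 2 - 3 * linearModel.γ * w linearModel
      = 3 ^ 2 := by norm_num [linearModel, w]
  rw [this, Real.sqrt_sq (by norm_num)]
  norm_num [linearModel]

theorem linearModel_nondegenerate :
    ∃ g : ℝ → ℝ, ContDiff ℝ ∞ g ∧ ¬ IsVacuumOn linearModel 1 g Set.univ :=
  exists_not_isVacuumOn _ _ 0 0 1 0 0 (Or.inl (by norm_num [Err, linearModel, quarticJet]))

theorem realized_linear (a₀ : ℝ) (m : ℕ) (hm : m ≤ 3)
    (h0 : ∀ j < m, quarticJet a₀ 1 0 0 0 j 0 = 0) (hne : quarticJet a₀ 1 0 0 0 m 0 ≠ 0) :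
    Realized IsLinearForm (classOfOrder m) :=
  realized_of_realizesByOrder one_pos (isLinearForm_linearModel a₀) linearModel_nondegenerate
    ((isLinearForm_linearModel a₀).isVacuumOn one_pos).2 m hm a₀ 1 0 0
    (by funext r; simp [quarticJet]) h0 hne

/-- Einstein gravity with a cosmological constant. -/
noncomputable def einsteinModel : Couplings where
  γ := 1
  Λ := 1
  α := 0
  β := 0
  η₁ := 0
  η₂ := 0
  η₃ := 0
  η₄ := 0
  η₅ := 0
  η₆ := 0
  η₇ := 0
  η₈ := 0

/-- With `a₂ = -1` and `R₀ = 1` the factor `a₂ R₀² + 1` vanishes, and `Λ = 1` settles the second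
condition. -/
theorem isQuadraticForm_einsteinModel (a₀ a₁ : ℝ) :
    IsQuadraticForm einsteinModel 1 (fun r => a₀ + a₁ * r + -1 * r ^ 2) :=
  ⟨a₀, a₁, -1, by norm_num, rfl, by norm_num, by norm_num [einsteinModel, c₁, c₂]⟩

theorem realized_quadratic (a₀ a₁ : ℝ) (m : ℕ) (hm : m ≤ 3)
    (h0 : ∀ j < m, quarticJet a₀ a₁ (-1) 0 0 j 0 = 0) (hne : quarticJet a₀ a₁ (-1) 0 0 m 0 ≠ 0) :
    Realized IsQuadraticForm (classOfOrder m) :=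
  realized_of_realizesByOrder one_pos (isQuadraticForm_einsteinModel a₀ a₁)
    (exists_not_isVacuumOn _ _ 0 0 0 0 0 (Or.inr (by norm_num [Eθθ, einsteinModel, quarticJet])))
    (isQuadraticForm_einsteinModel a₀ a₁).isVacuumOn.2 m hm a₀ a₁ (-1) 0
    (by funext r; simp [quarticJet]) h0 hne

/-- The values `γ = 4`, `c₂ = 9` give `R₀ = 1`, and `α = 3` equals `√(γ c₂) / 2`, so `Λ` stays free
to adjust `a₁`. -/
noncomputable def cubicModel (Λ : ℝ) : Couplings where
  γ := 4
  Λ := Λ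
  α := 3
  β := 0
  η₁ := -1
  η₂ := -1 / 3
  η₃ := 1 / 36
  η₄ := -1
  η₅ := 0
  η₆ := 0
  η₇ := 0
  η₈ := 4

theorem isCubicForm_cubicModel (Λ a₀ a₁ a₂ : ℝ) (ha : 3 * a₁ = a₂ ^ 2 + 2 * Λ - 1) :
    IsCubicForm (cubicModel Λ) 1 (fun r => a₀ + a₁ * r + a₂ * r ^ 2 + 1 * r ^ 3) := by
  refine ⟨by simp [cubicModel], rfl, by norm_num [cubicModel], by norm_num [cubicModel],
    by norm_num [cubicModel], by norm_num [cubicModel, w], ?_, Or.inr ⟨by norm_num [cubicModel], ?_⟩,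
    a₀, a₁, a₂, 1, one_ne_zero, ?_, rfl⟩
  · have : c₂ (cubicModel Λ) / (cubicModel Λ).γ = (3 / 2) ^ 2 := by norm_num [cubicModel, c₂]
    rw [this, Real.sqrt_sq (by norm_num)]
    norm_num
  · have : (cubicModel Λ).γ * c₂ (cubicModel Λ) = 6 ^ 2 := by norm_num [cubicModel, c₂]
    rw [this, Real.sqrt_sq (by norm_num)]
    norm_num [cubicModel]
  · simp only [cubicModel]
    linear_combination ha / 3

theorem cubicModel_nondegenerate (Λ : ℝ) :
    ∃ g : ℝ → ℝ, ContDiff ℝ ∞ g ∧ ¬ IsVacuumOn (cubicModel Λ) 1 g Set.univ := by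
  -- Neither test function works for all `Λ`: the `rr` equation of `f = 0` holds at `Λ = 1 / 2`,
  -- that of `f = r²` at `Λ = 0`.
  by_cases h : Λ = 0
  · exact exists_not_isVacuumOn _ _ 0 0 0 0 0 (Or.inl (by norm_num [Err, cubicModel, quarticJet, h]))
  · exact exists_not_isVacuumOn _ _ 0 0 1 0 0 (Or.inl (by
      norm_num [Err, cubicModel, quarticJet]; ring_nf; simpa using h))

theorem realized_cubic (Λ a₀ a₁ a₂ : ℝ) (ha : 3 * a₁ = a₂ ^ 2 + 2 * Λ - 1) (m : ℕ) (hm : m ≤ 3)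
    (h0 : ∀ j < m, quarticJet a₀ a₁ a₂ 1 0 j 0 = 0) (hne : quarticJet a₀ a₁ a₂ 1 0 m 0 ≠ 0) :
    Realized IsCubicForm (classOfOrder m) :=
  realized_of_realizesByOrder one_pos (isCubicForm_cubicModel Λ a₀ a₁ a₂ ha)
    (cubicModel_nondegenerate Λ)
    ((isCubicForm_cubicModel Λ a₀ a₁ a₂ ha).isVacuumOn one_pos).2 m hm a₀ a₁ a₂ 1
    (by funext r; simp [quarticJet]) h0 hne

noncomputable def cubicQuarticModel : Couplings where
  γ := 96
  Λ := 1
  α := -144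
  β := 0
  η₁ := 135
  η₂ := -9
  η₃ := 0
  η₄ := -26
  η₅ := 0
  η₆ := -210
  η₇ := 117 / 2
  η₈ := -351

theorem realized_cubicQuartic : Realized IsCubicQuarticForm .c1a := by
  have h : IsCubicQuarticForm cubicQuarticModel 1
      (fun r => 1 * r ^ 3 - 45 * 1 ^ 2 * r ^ 4 / (64 * cubicQuarticModel.Λ)) := by
    refine ⟨?_, ?_, ?_, ?_, ?_, ?_, ?_, ?_, ?_, 1, one_ne_zero, rfl⟩ <;>
      norm_num [cubicQuarticModel]
  exact ⟨_, _, _, 0, one_pos, h, exists_not_isVacuumOn _ _ 0 0 1 0 0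
    (Or.inl (by norm_num [Err, cubicQuarticModel, quarticJet])), (h.isVacuumOn one_pos).2.1⟩

noncomputable def quadraticQuarticModel : Couplings where
  γ := 1
  Λ := 2961 / 656
  α := -3 / 2
  β := 0
  η₁ := 391 / 984
  η₂ := -391 / 67896
  η₃ := 0
  η₄ := 52 / 1845
  η₅ := 0
  η₆ := 1201 / 1230
  η₇ := -1987 / 14760
  η₈ := -1162 / 615

theorem realized_quadraticQuartic : Realized IsQuadraticQuarticForm .c2 := by
  have h : IsQuadraticQuarticForm quadraticQuarticModel 1
      (fun r => 15 * quadraticQuarticModel.γ * r ^ 2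
        / (8 * (quadraticQuarticModel.α - 3 * quadraticQuarticModel.β)) + 1 * r ^ 4) := by
    refine ⟨?_, ?_, ?_, ?_, ?_, ?_, ?_, ?_, ?_, ?_, 1, one_ne_zero, rfl⟩ <;>
      norm_num [quadraticQuarticModel]
  exact ⟨_, _, _, 0, one_pos, h, exists_not_isVacuumOn _ _ 0 0 0 0 0
    (Or.inl (by norm_num [Err, quadraticQuarticModel, quarticJet])), (h.isVacuumOn one_pos).2⟩

/-- A model for `a₂ r² + a_p r^p` with `p = 4`. -/
noncomputable def twoTermModelFour (β : ℝ) : Couplings where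
  γ := 0
  Λ := 0
  α := 3 * β
  β := β
  η₁ := 9
  η₂ := 3
  η₃ := 0
  η₄ := 11
  η₅ := 0
  η₆ := -33
  η₇ := 27 / 4
  η₈ := -81 / 2

/-- At `p = 4` the numerator of the radius formula is `-12` and the denominator `12 (β + 8 a₂)`. The
free `β` allows both `a₂ = 0` and `a₂ = 1` with `R₀ = 1`. -/
theorem isTwoTermModel_twoTermModelFour {β a₂ : ℝ} (h : β + 8 * a₂ = 1) :
    IsTwoTermModel (twoTermModelFour β) 1 4 a₂ := by
  refine ⟨?_, ?_, ?_, ?_, ?_, ?_, ?_, ?_, ?_⟩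
  rotate_right
  · have : (4 - 1) * 4 * (twoTermModelFour β).β
        + (4 - 3) * (4 - 2) * (4 ^ 2 + 4 - 4) * a₂ * (twoTermModelFour β).η₂ = 12 := by
      simp only [twoTermModelFour]
      linear_combination 12 * h
    rw [this]
    norm_num [twoTermModelFour]
  all_goals norm_num [twoTermModelFour]

theorem twoTermModelFour_nondegenerate (β : ℝ) :
    ∃ g : ℝ → ℝ, ContDiff ℝ ∞ g ∧ ¬ IsVacuumOn (twoTermModelFour β) 1 g Set.univ := by
  refine exists_not_isVacuumOn _ _ 1 0 0 1 0 (Or.inr ?_)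
  simp only [Eθθ, twoTermModelFour, quarticJet, smul_eq_mul, Algebra.algebraMap_self_apply]
  ring_nf
  norm_num

/-- A model for `a_p r^p` with `p = -1` and `γ = 0`. -/
noncomputable def twoTermModelNeg : Couplings where
  γ := 0
  Λ := 0
  α := 3
  β := 1
  η₁ := 3
  η₂ := 1
  η₃ := 0
  η₄ := 31
  η₅ := 0
  η₆ := -93
  η₇ := 87 / 4
  η₈ := -261 / 2

theorem realized_twoTerm_c1b : Realized IsTwoTermForm .c1b := by
  have h := isTwoTermModel_twoTermModelFour (β := 1) (a₂ := 0) (by norm_num)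
  exact ⟨_, 1, twoTerm 4 0 1, 0, one_pos, ⟨4, 0, 1, one_ne_zero, h, rfl⟩,
    twoTermModelFour_nondegenerate 1, h.realizesAt_c1b one_pos one_ne_zero (by norm_num)⟩

theorem realized_twoTerm_c2 : Realized IsTwoTermForm .c2 := by
  have h := isTwoTermModel_twoTermModelFour (β := -7) (a₂ := 1) (by norm_num)
  have e : (4 : ℝ) = 2 + (2 : ℕ) := by norm_num
  refine ⟨_, 1, twoTerm 4 1 1, 0, one_pos, ⟨4, 1, 1, one_ne_zero, h, rfl⟩,
    twoTermModelFour_nondegenerate (-7), ?_⟩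
  rw [e] at h ⊢
  exact h.realizesAt_c2 one_pos one_ne_zero two_ne_zero

theorem realized_twoTerm_c3c : Realized IsTwoTermForm .c3c := by
  have h : IsTwoTermModel twoTermModelNeg 1 (-1) 0 := by
    refine ⟨?_, ?_, ?_, ?_, ?_, ?_, ?_, ?_, ?_⟩ <;> norm_num [twoTermModelNeg]
  exact ⟨_, 1, twoTerm (-1) 0 1, 0, one_pos, ⟨-1, 0, 1, one_ne_zero, h, rfl⟩,
    exists_not_isVacuumOn _ _ 1 0 0 1 0 (Or.inr (by norm_num [Eθθ, twoTermModelNeg, quarticJet])),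
    h.realizesAt_c3c one_pos one_ne_zero (by norm_num) (Or.inl rfl)⟩

/-- A model for `a_p r^p` with `p = 4` and `γ = 1`. -/
noncomputable def powerModelFour : Couplings where
  γ := 1
  Λ := 1 / 3
  α := -1 / 5
  β := -17 / 30
  η₁ := 0
  η₂ := 3 / 16
  η₃ := 0
  η₄ := 0
  η₅ := 0
  η₆ := 0
  η₇ := 13 / 16
  η₈ := -27 / 8

/-- A model for `a_p r^p` with `p = -1` and `γ = 1`. -/
noncomputable def powerModelNeg : Couplings where
  γ := 1
  Λ := 1 / 3
  α := -7 / 4140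
  β := -1 / 2 - 7 / 12420
  η₁ := 0
  η₂ := 7 / 414
  η₃ := 0
  η₄ := 0
  η₅ := 0
  η₆ := 0
  η₇ := 1243 / 1656
  η₈ := -829 / 276

theorem ne_of_quadratic_ne_zero {p : ℝ} (h : p * (5 * p - 21) + 20 ≠ 0) :
    p ≠ (21 + √41) / 10 ∧ p ≠ (21 - √41) / 10 := by
  have hs : √41 ^ 2 = (41 : ℝ) := Real.sq_sqrt (by norm_num)
  constructor <;> rintro rfl <;> apply h <;> linear_combination hs / 20

theorem realized_power_c1b : Realized IsPowerForm .c1b := by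
  have h : IsPowerModel powerModelFour 1 4 := by
    obtain ⟨h1, h2⟩ := ne_of_quadratic_ne_zero (p := 4) (by norm_num)
    refine ⟨?_, ?_, ?_, ?_, h1, h2, ?_, ?_, ?_, ?_, ?_, ?_, ?_⟩ <;> norm_num [powerModelFour]
  exact ⟨_, 1, _, 0, one_pos, ⟨4, 1, one_ne_zero, h, rfl⟩,
    exists_not_isVacuumOn _ _ 1 0 0 1 0 (Or.inl (by norm_num [Err, powerModelFour, quarticJet])),
    h.realizesAt_c1b one_pos one_ne_zero (by norm_num)⟩

theorem realized_power_c3c : Realized IsPowerForm .c3c := by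
  have h : IsPowerModel powerModelNeg 1 (-1) := by
    obtain ⟨h1, h2⟩ := ne_of_quadratic_ne_zero (p := -1) (by norm_num)
    refine ⟨?_, ?_, ?_, ?_, h1, h2, ?_, ?_, ?_, ?_, ?_, ?_, ?_⟩ <;> norm_num [powerModelNeg]
  exact ⟨_, 1, _, 0, one_pos, ⟨-1, 1, one_ne_zero, h, rfl⟩,
    exists_not_isVacuumOn _ _ 1 0 0 1 0 (Or.inl (by norm_num [Err, powerModelNeg, quarticJet])),
    h.realizesAt_c3c one_pos one_ne_zero (by norm_num)⟩

end Kundt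

/-! ### Assembly of the theorem -/

theorem mainTheorem6 :
    -- every formal series solution belongs to one of the six classes
    (∀ (M : Couplings) (R₀ : ℝ), 0 < R₀ → ∀ (n : ℝ) (a : ℕ → ℝ), a 0 ≠ 0 →
      Kundt.Err M R₀ (Kundt.formalJet (Kundt.frobenius n a)) = 0 →
      Kundt.Eθθ M R₀ (Kundt.formalJet (Kundt.frobenius n a)) = 0 →
      ∃ K : Kundt.IndicialClass, Kundt.InClass M R₀ n (a 0) K) ∧
    -- every solution with a convergent series belongs to one of the six classes
    (∀ (M : Couplings) (R₀ : ℝ), 0 < R₀ → ∀ (f : ℝ → ℝ) (r₀ n : ℝ) (a : ℕ → ℝ),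
      Kundt.HasFrobeniusSeries f r₀ n a →
      (∀ᶠ r in 𝓝[>] r₀,
        Kundt.Err M R₀ (Kundt.jet f r) = 0 ∧ Kundt.Eθθ M R₀ (Kundt.jet f r) = 0) →
      ∃ K : Kundt.IndicialClass, Kundt.InClass M R₀ n (a 0) K) ∧
    -- the closed-form functions are solutions, and these are the classes of their expansions
    (∀ (M : Couplings) (R₀ : ℝ) (f : ℝ → ℝ), 0 < R₀ →
      (Kundt.IsLinearForm M R₀ f ∨ Kundt.IsQuadraticForm M R₀ f ∨ Kundt.IsCubicForm M R₀ f) →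
      Kundt.IsVacuumOn M R₀ f Set.univ ∧ Kundt.RealizesByOrder M R₀ f) ∧
    (∀ (M : Couplings) (R₀ : ℝ) (f : ℝ → ℝ), 0 < R₀ → Kundt.IsCubicQuarticForm M R₀ f →
      Kundt.IsVacuumOn M R₀ f Set.univ ∧ Kundt.RealizesAt M R₀ f 0 .c1a ∧
        Kundt.q₁ M R₀ = -18 * M.γ / M.Λ ^ 4 ∧ Kundt.q₁ M R₀ ≠ 0) ∧
    (∀ (M : Couplings) (R₀ p a₂ ap : ℝ), 0 < R₀ → ap ≠ 0 → Kundt.IsTwoTermModel M R₀ p a₂ →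
      Kundt.IsVacuumOn M R₀ (Kundt.twoTerm p a₂ ap) (Set.Ioi 0) ∧
      (a₂ = 0 → 2 < p → Kundt.RealizesAt M R₀ (Kundt.twoTerm p a₂ ap) 0 .c1b) ∧
      (a₂ ≠ 0 → (∃ k : ℕ, 0 < k ∧ p = 2 + k) →
        Kundt.RealizesAt M R₀ (Kundt.twoTerm p a₂ ap) 0 .c2) ∧
      (p < 2 → (a₂ = 0 ∨ ∃ k : ℕ, p = 2 - k) →
        Kundt.RealizesAt M R₀ (Kundt.twoTerm p a₂ ap) 0 .c3c)) ∧
    (∀ (M : Couplings) (R₀ p ap : ℝ), 0 < R₀ → ap ≠ 0 → Kundt.IsPowerModel M R₀ p →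
      Kundt.IsVacuumOn M R₀ (fun r => ap * r ^ p) (Set.Ioi 0) ∧
      (2 < p → Kundt.RealizesAt M R₀ (fun r => ap * r ^ p) 0 .c1b) ∧
      (p < 2 → Kundt.RealizesAt M R₀ (fun r => ap * r ^ p) 0 .c3c)) ∧
    (∀ (M : Couplings) (R₀ : ℝ) (f : ℝ → ℝ), 0 < R₀ → Kundt.IsQuadraticQuarticForm M R₀ f →
      Kundt.IsVacuumOn M R₀ f Set.univ ∧ Kundt.RealizesAt M R₀ f 0 .c2) ∧
    -- each class is realized by closed-form solutions, in non-degenerate models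
    Kundt.Realized Kundt.IsCubicForm .c1a ∧
    Kundt.Realized Kundt.IsCubicQuarticForm .c1a ∧
    Kundt.Realized Kundt.IsTwoTermForm .c1b ∧
    Kundt.Realized Kundt.IsPowerForm .c1b ∧
    Kundt.Realized Kundt.IsQuadraticForm .c2 ∧
    Kundt.Realized Kundt.IsCubicForm .c2 ∧
    Kundt.Realized Kundt.IsTwoTermForm .c2 ∧
    Kundt.Realized Kundt.IsQuadraticQuarticForm .c2 ∧
    Kundt.Realized Kundt.IsLinearForm .c3a ∧
    Kundt.Realized Kundt.IsQuadraticForm .c3a ∧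
    Kundt.Realized Kundt.IsCubicForm .c3a ∧
    Kundt.Realized Kundt.IsLinearForm .c3b ∧
    Kundt.Realized Kundt.IsQuadraticForm .c3b ∧
    Kundt.Realized Kundt.IsCubicForm .c3b ∧
    Kundt.Realized Kundt.IsTwoTermForm .c3c ∧
    Kundt.Realized Kundt.IsPowerForm .c3c := by
  refine ⟨fun M R₀ _ n a ha hr hθ => Kundt.exists_inClass_of_formal M R₀ n a ha hr hθ,
    fun M R₀ _ f r₀ n a hf hE => Kundt.exists_inClass_of_hasFrobeniusSeries M R₀ hf hE, ?_,
    fun M R₀ f hR h => h.isVacuumOn hR, ?_, ?_, fun M R₀ f hR h => h.isVacuumOn hR,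
    ?_, Kundt.realized_cubicQuartic, Kundt.realized_twoTerm_c1b, Kundt.realized_power_c1b, ?_, ?_,
    Kundt.realized_twoTerm_c2, Kundt.realized_quadraticQuartic, ?_, ?_, ?_, ?_, ?_, ?_,
    Kundt.realized_twoTerm_c3c, Kundt.realized_power_c3c⟩
  · rintro M R₀ f hR (h | h | h)
    · exact h.isVacuumOn hR
    · exact h.isVacuumOn
    · exact h.isVacuumOn hR
  · refine fun M R₀ p a₂ ap hR hap h => ⟨h.isVacuumOn hR ap, ?_, ?_, fun hp ha =>
      h.realizesAt_c3c hR hap hp ha⟩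
    · rintro rfl hp
      exact h.realizesAt_c1b hR hap hp
    · rintro ha ⟨k, hk, rfl⟩
      exact h.realizesAt_c2 hR ha hk.ne'
  · refine fun M R₀ p ap hR hap h => ⟨?_, h.realizesAt_c1b hR hap, h.realizesAt_c3c hR hap⟩
    rw [← Kundt.twoTerm_zero]
    exact h.isVacuumOn hR ap
  -- `Λ = 1 / 2` and `a₂ = 0` give `a₁ = 0`, so `f = r³`.
  · refine Kundt.realized_cubic (1 / 2) 0 0 0 (by norm_num) 3 le_rfl (fun j hj => ?_) ?_
    · interval_cases j <;> simp [Kundt.quarticJet]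
    · simp [Kundt.quarticJet]
  · refine Kundt.realized_quadratic 0 0 2 (by norm_num) (fun j hj => ?_) ?_
    · interval_cases j <;> simp [Kundt.quarticJet]
    · simp [Kundt.quarticJet]
  -- `Λ = 0` and `a₂ = 1` also give `a₁ = 0`, but now `f = r² + r³`.
  · refine Kundt.realized_cubic 0 0 0 1 (by norm_num) 2 (by norm_num) (fun j hj => ?_) ?_
    · interval_cases j <;> simp [Kundt.quarticJet]
    · simp [Kundt.quarticJet]
  · refine Kundt.realized_linear 0 1 (by norm_num) (fun j hj => ?_) ?_
    · interval_cases j; simp [Kundt.quarticJet]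
    · simp [Kundt.quarticJet]
  · refine Kundt.realized_quadratic 0 1 1 (by norm_num) (fun j hj => ?_) ?_
    · interval_cases j; simp [Kundt.quarticJet]
    · simp [Kundt.quarticJet]
  · refine Kundt.realized_cubic 0 0 (-1 / 3) 0 (by norm_num) 1 (by norm_num) (fun j hj => ?_) ?_
    · interval_cases j; simp [Kundt.quarticJet]
    · simp [Kundt.quarticJet]
  · refine Kundt.realized_linear 1 0 (by norm_num) (fun j hj => ?_) ?_
    · omega
    · simp [Kundt.quarticJet]
  · refine Kundt.realized_quadratic 1 0 0 (by norm_num) (fun j hj => ?_) ?_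
    · omega
    · simp [Kundt.quarticJet]
  · refine Kundt.realized_cubic 0 1 (-1 / 3) 0 (by norm_num) 0 (by norm_num) (fun j hj => ?_) ?_
    · omega
    · simp [Kundt.quarticJet]
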